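/- **Setting.** Let $\mathcal X,\mathcal Y$ be measurable spaces (for instance Borel subsets of $\mathbb R^d$), $c,B\in\mathbb N$, $\alpha\in(0,1)$, and let $F_{tr}\in\{-1,+1\}^c$ be a fixed sign vector (in the procedure it is computed, as are the kernels, from training data independent of the test data, and is treated as fixed). A *bounded characteristic kernel* is a bounded measurable symmetric positive semidefinite real function $\kappa$ of two arguments such that $P\mapsto\int\kappa(\cdot,y)\,dP(y)$ is injective on probability measures. For a kernel $\kappa$ let $h_{\rm MMD}^{(\kappa)}((x,y),(x',y'))=\kappa(x,x')+\kappa(y,y')-\kappa(x,y')-\kappa(y,x')$. *The test.* Given core functions $\boldsymbol h=(h_1,\dots,h_c)$, a sample $w_1,\dots,w_n$, a simulated null sample $w'_1,\dots,w'_n$ and independent Rademacher signs $\epsilon^b_i$ ($b\le B$, $i\le n$), put $$\boldsymbol U_n=\tbinom n2^{-1}\sum_{i<j}\boldsymbol h(w_i,w_j),\quad \boldsymbol U_n^b=\tbinom n2^{-1}\sum_{i<j}\epsilon^b_i\epsilon^b_j\boldsymbol h(w_i,w_j),\quad (\widehat\Sigma_{H_0})_{a,a'}=n^2\tbinom n2^{-2}\sum_{i<j}h_a(w'_i,w'_j)h_{a'}(w'_i,w'_j),$$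 and let $\widehat L_{H_0}$ be the positive semidefinite square root of $\widehat\Sigma_{H_0}$ (if it is singular, which has vanishing probability under the assumptions of the power statement below, $\widehat L_{H_0}^{-1}$ is read as $0$ and the test does not reject; for $n<2$ all sums are read as $0$). Let $\mathrm{sgn}(a)=1$ for $a\ge0$ and $-1$ for $a<0$, and for $u\in\mathbb R^c$ let $\mathcal T(u)=n^2\sum_a \mathbb I[\mathrm{sgn}(v_a)=F_{tr,a}]\,v_a^2$ with $v=\widehat L_{H_0}^{-1}u$. With $\mathcal T^b=\mathcal T(\boldsymbol U_n^b)$ for $b\le B$ and $\mathcal T=\mathcal T^{B+1}=\mathcal T(\boldsymbol U_n)$, the DUAL test rejects when $\mathcal T>\hat\tau_\alpha$, where $\hat\tau_\alpha=\inf\{\tau\in\mathbb R:1-\alpha\le\frac1{B+1}\sum_{b=1}^{B+1}\mathbb I[\mathcal T^b\le\tau]\}$. *MMD-DUAL (testing $H_0:P=Q$ for probability measures $P,Q$ on $\mathcal X$).* The kernels are bounded characteristic kernels $\kappa_1,\dots,\kappa_c$ on $\mathcal X$; $h_a=h^{(\kappa_a)}_{\rm MMD}$; $w_i=(x_i,y_i)$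 with independent i.i.d. samples $x_i\sim P$, $y_i\sim Q$; and the $w'_i$ are pairs of independent draws with replacement from the pooled sample $\{x_1,\dots,x_n,y_1,\dots,y_n\}$. Let $\mathbb W=P\otimes Q$ and $\mathbb W_0=M\otimes M$, $M=\frac12(P+Q)$. *HSIC-DUAL (testing $H_0:U_{xy}=U_x\otimes U_y$ for a probability measure $U_{xy}$ on $\mathcal X\times\mathcal Y$ with marginals $U_x,U_y$).* The kernels are products $\gamma_a\otimes\ell_a$ of bounded characteristic kernels $\gamma_a$ on $\mathcal X$ and $\ell_a$ on $\mathcal Y$; $h_a((x_1,x_2,y_1,y_2),(x_1',x_2',y_1',y_2'))=\frac14h_{\rm MMD}^{(\gamma_a)}((x_1,x_2),(x_1',x_2'))\,h_{\rm MMD}^{(\ell_a)}((y_1,y_2),(y_1',y_2'))$; from $m$ i.i.d. observations $(x_i,y_i)\sim U_{xy}$, with $n=\lfloor m/2\rfloor$, $w_i=(x_i,x_{i+n},y_i,y_{i+n})$; and the $w'_i$ consist of two draws with replacement from $\{x_1,\dots,x_{2n}\}$ and, independently, two from $\{y_1,\dots,y_{2n}\}$. Let $\mathbb W$ be the law of $w_1$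 and $\mathbb W_0$ the law of $(x_1,x_2,y_1,y_2)$ with independent entries $x_i\sim U_x$, $y_i\sim U_y$. In both cases let $\boldsymbol U(\mathbb W)=E[\boldsymbol h(w_1,w_2)]$ for independent $w_1,w_2\sim\mathbb W$, let $(\Sigma_{H_0})_{a,a'}=2E[h_a(w_1,w_2)h_{a'}(w_1,w_2)]$ for independent $w_1,w_2\sim\mathbb W_0$, and let $L_{H_0}$ be the positive semidefinite square root of $\Sigma_{H_0}$. **Theorem 1.** For both MMD-DUAL and HSIC-DUAL: 1. Under $H_0$, for every sample size ($n$, resp. $m$) the test rejects with probability at most $\alpha$. 2. Suppose that $H_0$ fails for the fixed law(s), that $\alpha(B+1)\ge1$, that $\Sigma_{H_0}$ is positive definite, and (Assumption 1) that there is at least one index $a$ with $(L_{H_0}^{-1}\boldsymbol U(\mathbb W))_a\ne0$ and $F_{tr,a}=\mathrm{sgn}\big((L_{H_0}^{-1}\boldsymbol U(\mathbb W))_a\big)$. Then the probability that the test rejects tends to $1$ as the sample size tends to infinity. -/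

import Mathlib

open MeasureTheory ProbabilityTheory Filter Topology
open scoped MatrixOrder

noncomputable section

namespace DUAL

/-! ### Kernels -/

/-- `κ` is a bounded characteristic kernel: a measurable real kernel (symmetric and positive
semidefinite), bounded, whose mean embedding `P ↦ ∫ κ(·, y) dP(y)` is injective on the
probability measures. -/
structure IsBoundedCharacteristicKernel {𝒳 : Type*} [MeasurableSpace 𝒳] (κ : 𝒳 → 𝒳 → ℝ) :
    Prop where
  measurable : Measurable (fun p : 𝒳 × 𝒳 => κ p.1 p.2)
  posSemidef : Matrix.PosSemidef (Matrix.of κ)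
  bounded : ∃ C : ℝ, ∀ x y, |κ x y| ≤ C
  characteristic : ∀ P Q : Measure 𝒳, IsProbabilityMeasure P → IsProbabilityMeasure Q →
    (∀ x, ∫ y, κ x y ∂P = ∫ y, κ x y ∂Q) → P = Q

/-- The core function of the squared MMD. -/
def hMMD {𝒳 : Type*} (κ : 𝒳 → 𝒳 → ℝ) (w w' : 𝒳 × 𝒳) : ℝ :=
  κ w.1 w'.1 + κ w.2 w'.2 - κ w.1 w'.2 - κ w.2 w'.1

/-- The second-order core function of HSIC, on quadruples `((x₁, x₂), (y₁, y₂))`. -/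
def hHSIC {𝒳 𝒴 : Type*} (γ : 𝒳 → 𝒳 → ℝ) (l : 𝒴 → 𝒴 → ℝ)
    (w w' : (𝒳 × 𝒳) × (𝒴 × 𝒴)) : ℝ :=
  1 / 4 * hMMD γ w.1 w'.1 * hMMD l w.2 w'.2

/-! ### The statistic, the wild bootstrap and the test, for a general family of core functions -/

section Test

variable {𝒲 : Type*} {c n : ℕ}

/-- `∑_{i₁ < i₂} f i₁ i₂`. -/
def sumPairs (n : ℕ) (f : Fin n → Fin n → ℝ) : ℝ :=
  ∑ p : Fin n × Fin n with p.1 < p.2, f p.1 p.2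

/-- The multivariate second-order `U`-statistic. -/
def uStat (h : Fin c → 𝒲 → 𝒲 → ℝ) (w : Fin n → 𝒲) : Fin c → ℝ :=
  fun a => ((n.choose 2 : ℕ) : ℝ)⁻¹ * sumPairs n fun i j => h a (w i) (w j)

/-- The wild bootstrap version of the multivariate `U`-statistic, with signs `ε`. -/
def wildUStat (h : Fin c → 𝒲 → 𝒲 → ℝ) (w : Fin n → 𝒲) (ε : Fin n → ℤˣ) : Fin c → ℝ :=
  fun a => ((n.choose 2 : ℕ) : ℝ)⁻¹ *
    sumPairs n fun i j => ((ε i : ℤ) : ℝ) * ((ε j : ℤ) : ℝ) * h a (w i) (w j)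

/-- The second-order covariance estimator `Σ̂_{H₀}`, computed on a simulated null sample `w'`. -/
def covEst (h : Fin c → 𝒲 → 𝒲 → ℝ) (w' : Fin n → 𝒲) : Matrix (Fin c) (Fin c) ℝ :=
  Matrix.of fun a b => (n : ℝ) ^ 2 * (((n.choose 2 : ℕ) : ℝ) ^ 2)⁻¹ *
    sumPairs n fun i j => h a (w' i) (w' j) * h b (w' i) (w' j)

/-- `L⁻¹ u`, where `L` is the (principal, positive semidefinite) square root of `S`, `S = L L`.
For singular `S` the matrix inverse is `0`. -/
def whiten (S : Matrix (Fin c) (Fin c) ℝ) (u : Fin c → ℝ) : Fin c → ℝ :=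
  Matrix.mulVec (CFC.sqrt S)⁻¹ u

/-- The signum, with `sgn 0 = 1`. -/
def sgn (a : ℝ) : ℤˣ := if 0 ≤ a then 1 else -1

/-- `n² ‖F ⊙ v‖₂²`, where `F_a = 1` if `sgn v_a` is the training sign `Ftr_a`, and `F_a = 0`
otherwise. -/
def selStat (n : ℕ) (Ftr : Fin c → ℤˣ) (v : Fin c → ℝ) : ℝ :=
  (n : ℝ) ^ 2 * ∑ a, ((if sgn (v a) = Ftr a then 1 else 0) * v a) ^ 2

/-- The empirical `(1 - α)`-quantile of `T 0, …, T B`. -/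
def threshold {B : ℕ} (α : ℝ) (T : Fin (B + 1) → ℝ) : ℝ :=
  sInf {τ : ℝ | 1 - α ≤ 1 / ((B : ℝ) + 1) * ∑ b, if T b ≤ τ then (1 : ℝ) else 0}

/-- The test rejects: the statistic exceeds the threshold computed from the `B` wild bootstrap
statistics together with the statistic itself. Here `w` is the test sample, `w'` the simulated
null sample, and `ε b` the signs of the `b`-th bootstrap iteration. -/
def Rejects {B : ℕ} (α : ℝ) (Ftr : Fin c → ℤˣ) (h : Fin c → 𝒲 → 𝒲 → ℝ)
    (w w' : Fin n → 𝒲) (ε : Fin B → Fin n → ℤˣ) : Prop :=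
  let T : ℝ := selStat n Ftr (whiten (covEst h w') (uStat h w))
  let Tb : Fin B → ℝ := fun b => selStat n Ftr (whiten (covEst h w') (wildUStat h w (ε b)))
  threshold α (Fin.snoc (α := fun _ => ℝ) Tb T) < T

end Test

/-! ### Randomness of the procedure -/

/-- The Rademacher distribution. -/
def rademacher : Measure ℤˣ :=
  (2⁻¹ : ENNReal) • Measure.dirac 1 + (2⁻¹ : ENNReal) • Measure.dirac (-1)

/-- The law of the independent Rademacher signs of `B` bootstrap iterations. -/
def signLaw (B n : ℕ) : Measure (Fin B → Fin n → ℤˣ) :=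
  Measure.pi fun _ => Measure.pi fun _ => rademacher

/-- The law of `n` pairs of independent, uniformly distributed indices of a pool of `2 n`
observations (`n` indices with two slots each), i.e. of drawing with replacement. -/
def resampleLaw (n : ℕ) : Measure (Fin n → Fin 2 → Fin n × Fin 2) :=
  Measure.pi fun _ => Measure.pi fun _ => uniformOn Set.univ

/-- Draw pairs from the pool of all entries of the pairs `v k`: the entry `(k, 0)` of the pool is
`(v k).1`, and the entry `(k, 1)` is `(v k).2`. -/
def resample {𝒳 : Type*} {n : ℕ} (v : Fin n → 𝒳 × 𝒳) (J : Fin n → Fin 2 → Fin n × Fin 2)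
    (i : Fin n) : 𝒳 × 𝒳 :=
  let pool : Fin n × Fin 2 → 𝒳 := fun r => if r.2 = 0 then (v r.1).1 else (v r.1).2
  (pool (J i 0), pool (J i 1))

/-! ### Population quantities -/

/-- `U(𝕎) = E h(w₁, w₂)` for independent `w₁, w₂ ∼ W`. -/
def popU {𝒲 : Type*} [MeasurableSpace 𝒲] {c : ℕ} (h : Fin c → 𝒲 → 𝒲 → ℝ) (W : Measure 𝒲) :
    Fin c → ℝ :=
  fun a => ∫ p, h a p.1 p.2 ∂(W.prod W)

/-- The limit `Σ_{H₀} = 2 E[h_a(w₁, w₂) h_b(w₁, w₂)]`, for independent `w₁, w₂ ∼ W₀`, of the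
covariance matrix of `n U_n` computed on an i.i.d. sample from the null law `W₀`. -/
def nullCov {𝒲 : Type*} [MeasurableSpace 𝒲] {c : ℕ} (h : Fin c → 𝒲 → 𝒲 → ℝ) (W₀ : Measure 𝒲) :
    Matrix (Fin c) (Fin c) ℝ :=
  Matrix.of fun a b => 2 * ∫ p, h a p.1 p.2 * h b p.1 p.2 ∂(W₀.prod W₀)

/-- The training signs agree with the signs of `L_{H₀}⁻¹ U(𝕎)` in at least one coordinate,
at which the latter vector does not vanish. -/
def SignAgreement {c : ℕ} (Ftr : Fin c → ℤˣ) (S : Matrix (Fin c) (Fin c) ℝ) (u : Fin c → ℝ) :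
    Prop :=
  ∃ a, whiten S u a ≠ 0 ∧ Ftr a = sgn (whiten S u a)

/-! ### Two-sample testing -/

section MMD

variable {𝒳 : Type*} [MeasurableSpace 𝒳]

/-- The law of the pair `(x, y)` of independent `x ∼ P` and `y ∼ Q`. -/
def mmdLaw (P Q : Measure 𝒳) : Measure (𝒳 × 𝒳) := P.prod Q

/-- The null law simulated by resampling from the pooled sample: both entries are independent
draws from the mixture `(P + Q) / 2`. -/
def mmdNullLaw (P Q : Measure 𝒳) : Measure (𝒳 × 𝒳) :=
  ((2⁻¹ : ENNReal) • (P + Q)).prod ((2⁻¹ : ENNReal) • (P + Q))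

/-- The probability that MMD-DUAL rejects, for independent i.i.d. test samples `x ∼ Pⁿ`, `y ∼ Qⁿ`,
resampling indices `J` and bootstrap signs `ε`. -/
def mmdRejectProb {c : ℕ} (B : ℕ) (α : ℝ) (Ftr : Fin c → ℤˣ) (κ : Fin c → 𝒳 → 𝒳 → ℝ)
    (P Q : Measure 𝒳) (n : ℕ) : ℝ :=
  ((((Measure.pi fun _ : Fin n => P).prod (Measure.pi fun _ : Fin n => Q)).prod
      (resampleLaw n)).prod (signLaw B n)).real
    {ω : (((Fin n → 𝒳) × (Fin n → 𝒳)) × (Fin n → Fin 2 → Fin n × Fin 2)) ×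
        (Fin B → Fin n → ℤˣ) |
      let x := ω.1.1.1
      let y := ω.1.1.2
      let J := ω.1.2
      let ε := ω.2
      let w : Fin n → 𝒳 × 𝒳 := fun i => (x i, y i)
      Rejects α Ftr (fun a => hMMD (κ a)) w (resample w J) ε}

end MMD

/-! ### Independence testing -/

section HSIC

variable {𝒳 𝒴 : Type*} [MeasurableSpace 𝒳] [MeasurableSpace 𝒴]

/-- The quadruples `((xᵢ, xᵢ₊ₙ), (yᵢ, yᵢ₊ₙ))`, `n = ⌊m / 2⌋`, formed from `m` observations. -/
def quadruples {m : ℕ} (z : Fin m → 𝒳 × 𝒴) (i : Fin (m / 2)) : (𝒳 × 𝒳) × (𝒴 × 𝒴) :=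
  let z₁ := z ⟨i, by omega⟩
  let z₂ := z ⟨i + m / 2, by omega⟩
  ((z₁.1, z₂.1), (z₁.2, z₂.2))

/-- The law of the quadruple `((x₁, x₂), (y₁, y₂))` for independent `(x₁, y₁), (x₂, y₂) ∼ U`. -/
def hsicLaw (U : Measure (𝒳 × 𝒴)) : Measure ((𝒳 × 𝒳) × (𝒴 × 𝒴)) :=
  (U.prod U).map fun q => ((q.1.1, q.2.1), (q.1.2, q.2.2))

/-- The null law simulated by resampling the `x`'s and the `y`'s separately: the product of the
marginals. -/
def hsicNullLaw (U : Measure (𝒳 × 𝒴)) : Measure ((𝒳 × 𝒳) × (𝒴 × 𝒴)) :=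
  (U.fst.prod U.fst).prod (U.snd.prod U.snd)

/-- The probability that HSIC-DUAL rejects, for `m` i.i.d. test observations from `U`, independent
resampling indices `J` (for the `x`'s) and `K` (for the `y`'s) and bootstrap signs `ε`. -/
def hsicRejectProb {c : ℕ} (B : ℕ) (α : ℝ) (Ftr : Fin c → ℤˣ) (γ : Fin c → 𝒳 → 𝒳 → ℝ)
    (l : Fin c → 𝒴 → 𝒴 → ℝ) (U : Measure (𝒳 × 𝒴)) (m : ℕ) : ℝ :=
  (((Measure.pi fun _ : Fin m => U).prod
      ((resampleLaw (m / 2)).prod (resampleLaw (m / 2)))).prod (signLaw B (m / 2))).real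
    {ω : ((Fin m → 𝒳 × 𝒴) ×
        ((Fin (m / 2) → Fin 2 → Fin (m / 2) × Fin 2) ×
          (Fin (m / 2) → Fin 2 → Fin (m / 2) × Fin 2))) × (Fin B → Fin (m / 2) → ℤˣ) |
      let z := ω.1.1
      let J := ω.1.2.1
      let K := ω.1.2.2
      let ε := ω.2
      let w := quadruples z
      let w' : Fin (m / 2) → (𝒳 × 𝒳) × (𝒴 × 𝒴) := fun i =>
        (resample (fun k => (w k).1) J i, resample (fun k => (w k).2) K i)
      Rejects α Ftr (fun a => hHSIC (γ a) (l a)) w w' ε}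

end HSIC

end DUAL

end

noncomputable section

namespace DUAL

/-! ### The square root of a positive semidefinite matrix -/

section Sqrt

variable {ι : Type*} [Fintype ι]

/-! Level. The observed statistic is the bootstrap statistic with trivial signs. The core functions
are odd under a flip of one observation: swapping `x_i` and `y_i` for MMD, or `x_i` and `x_{i+n}`
with the `y`'s kept for HSIC. Under `H₀` a flip preserves the law of the sample. The simulated null
sample is unchanged if the uniform resampling indices are relabelled along with the flip, and
relabelling preserves their law. Hence the whitening matrix is untouched, a flip by `δ` multiplies
all `B + 1` sign vectors by `δ`, and the trivial one may be replaced by a uniform `δ`. The `B + 1`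
statistics then have exchangeable sign vectors, and at most `α (B + 1)` of them exceed the
threshold, for every sample size (`measureReal_rejects_le`, `poolRejectProb_le`).

Power. Averages over pairs have vanishing variance once terms with disjoint indices are nearly
uncorrelated, since only `O(n³)` of the `O(n⁴)` pairs of pairs share an index. So `uStat` tends to
its mean, the bootstrap versions tend to `0` thanks to their signs, and `covEst` tends to `nullCov`;
for the latter, drawing with replacement differs from independent sampling only when two slots hit
the same observation, which costs `O(1/n)`. Whitening is continuous at a positive definite limit.
The agreeing coordinate therefore keeps the observed statistic above every bootstrap statistic, the
common factor `n²` being irrelevant, and being the strict maximum suffices when `α (B + 1) ≥ 1`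
(`exists_forall_selStat_lt`, `threshold_lt_of_forall_lt`, `tendsto_poolRejectProb`).

Both procedures are instances of one scheme, a sample of law `W` and a null sample assembled by a
map `Φ` from slots filled out of the pool, so each half is proved once. -/

theorem isClosed_posSemidef : IsClosed {S : Matrix ι ι ℝ | S.PosSemidef} := by
  have h : {S : Matrix ι ι ℝ | S.PosSemidef} =
      {S | S.conjTranspose = S} ∩ ⋂ x : ι → ℝ, {S | 0 ≤ star x ⬝ᵥ (S.mulVec x)} := by
    ext S
    simp [Matrix.posSemidef_iff_dotProduct_mulVec, Matrix.IsHermitian]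
  rw [h]
  refine (isClosed_eq (by fun_prop) continuous_id).inter (isClosed_iInter fun x => ?_)
  exact isClosed_le continuous_const (by fun_prop)

/-- For symmetric `R` the trace of `R * R` is the sum of the squared entries of `R`. This confines
square roots to a compact box. -/
theorem abs_le_of_mul_self_eq {R S : Matrix ι ι ℝ} (hR : R.PosSemidef) (h : R * R = S) (i j : ι) :
    |R i j| ≤ 1 + S.trace := by
  have hsymm : R.transpose = R := by simpa [Matrix.IsSymm] using hR.isHermitian
  have htr : S.trace = ∑ k, ∑ l, R k l ^ 2 := by
    rw [← h, Matrix.trace]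
    refine Finset.sum_congr rfl fun k _ => ?_
    rw [Matrix.diag_apply, Matrix.mul_apply]
    refine Finset.sum_congr rfl fun l _ => ?_
    rw [sq, show R l k = R k l from congrFun (congrFun hsymm k) l]
  have hle : R i j ^ 2 ≤ S.trace := by
    rw [htr]
    refine le_trans ?_ (Finset.single_le_sum (f := fun k => ∑ l, R k l ^ 2)
      (fun k _ => Finset.sum_nonneg fun l _ => sq_nonneg _) (Finset.mem_univ i))
    exact Finset.single_le_sum (f := fun l => R i l ^ 2) (fun l _ => sq_nonneg _)
      (Finset.mem_univ j)
  have := sq_abs (R i j)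
  nlinarith [abs_nonneg (R i j)]

variable [DecidableEq ι]

theorem posSemidef_sqrt (S : Matrix ι ι ℝ) : (CFC.sqrt S).PosSemidef :=
  Matrix.nonneg_iff_posSemidef.mp (CFC.sqrt_nonneg S)

/-- A compactness argument: roots of nearby matrices stay in a compact box, and each cluster point
is positive semidefinite with square `S`, hence is the root of `S` by uniqueness. -/
theorem continuousOn_matrix_sqrt :
    ContinuousOn (CFC.sqrt : Matrix ι ι ℝ → Matrix ι ι ℝ) {S | S.PosSemidef} := by
  intro S hS
  -- Nearby traces are below `S.trace + 1`, so the entry bound `1 + trace` becomes `2 + S.trace`.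
  let K : Set (Matrix ι ι ℝ) :=
    Set.univ.pi fun _ : ι => Set.univ.pi fun _ : ι => Set.Icc (-(2 + S.trace)) (2 + S.trace)
  have hK : IsCompact K := isCompact_univ_pi fun _ => isCompact_univ_pi fun _ => isCompact_Icc
  have htr : ∀ᶠ S' : Matrix ι ι ℝ in 𝓝[{S | S.PosSemidef}] S, S'.trace < S.trace + 1 := by
    have hc : Continuous fun S' : Matrix ι ι ℝ => S'.trace := by fun_prop
    exact (hc.continuousAt.eventually_lt continuousAt_const (by linarith)).filter_mono
      nhdsWithin_le_nhds
  have hsq : ∀ S' : Matrix ι ι ℝ, S'.PosSemidef → CFC.sqrt S' * CFC.sqrt S' = S' := fun S' hS' =>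
    CFC.sqrt_mul_sqrt_self S' (Matrix.nonneg_iff_posSemidef.mpr hS')
  refine hK.tendsto_nhds_of_unique_mapClusterPt ?_ fun R _ hR => ?_
  · filter_upwards [htr, self_mem_nhdsWithin] with S' h1 h2 i _ j _
    have := abs_le.mp (abs_le_of_mul_self_eq (posSemidef_sqrt S') (hsq S' h2) i j)
    exact ⟨by linarith [this.1], by linarith [this.2]⟩
  · have hRpos : R.PosSemidef := 
      isClosed_posSemidef.mem_of_mapClusterPt hR (Eventually.of_forall posSemidef_sqrt)
    have hc : Continuous fun R : Matrix ι ι ℝ => R * R := by fun_prop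
    have h1 : MapClusterPt (R * R) (𝓝[{S | S.PosSemidef}] S)
        (fun S' => CFC.sqrt S' * CFC.sqrt S') := hR.continuousAt_comp hc.continuousAt
    have h2 : Tendsto (fun S' : Matrix ι ι ℝ => CFC.sqrt S' * CFC.sqrt S')
        (𝓝[{S | S.PosSemidef}] S) (𝓝 S) := by
      refine (tendsto_id'.mpr nhdsWithin_le_nhds : Tendsto id _ (𝓝 S)).congr' ?_
      filter_upwards [self_mem_nhdsWithin] with S' hS'
      exact (hsq S' hS').symm
    have h3 : R * R = S := by
      have h4 : ClusterPt (R * R) (𝓝 S) := ClusterPt.mono h1 h2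
      exact eq_of_nhds_neBot h4
    exact (CFC.sqrt_unique h3 (Matrix.nonneg_iff_posSemidef.mpr hRpos)).symm

end Sqrt

/-! ### Whitening -/

section Whiten

variable {c : ℕ}

/-- The root of a positive definite matrix has nonzero determinant, and matrix inversion is
continuous there. The filter stays inside the positive semidefinite matrices, where the root is
known to be continuous. -/
theorem tendsto_whiten {S : Matrix (Fin c) (Fin c) ℝ} (hS : S.PosDef) (u : Fin c → ℝ) :
    Tendsto (fun p : Matrix (Fin c) (Fin c) ℝ × (Fin c → ℝ) => whiten p.1 p.2)
      (𝓝[{S | S.PosSemidef}] S ×ˢ 𝓝 u) (𝓝 (whiten S u)) := by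
  have hsqrt : Tendsto CFC.sqrt (𝓝[{S | S.PosSemidef}] S) (𝓝 (CFC.sqrt S)) :=
    continuousOn_matrix_sqrt S hS.posSemidef
  have hmul : CFC.sqrt S * CFC.sqrt S = S :=
    CFC.sqrt_mul_sqrt_self S (Matrix.nonneg_iff_posSemidef.mpr hS.posSemidef)
  have hdet : (CFC.sqrt S).det ≠ 0 := fun h => hS.det_pos.ne' (by
    rw [← hmul, Matrix.det_mul, h, zero_mul])
  have hinv : ContinuousAt (fun R : Matrix (Fin c) (Fin c) ℝ => R⁻¹) (CFC.sqrt S) := by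
    simp only [Matrix.inv_def, Ring.inverse_eq_inv']
    have hd : ContinuousAt (fun R : Matrix (Fin c) (Fin c) ℝ => R.det) (CFC.sqrt S) := by fun_prop
    exact (hd.inv₀ hdet).smul (by fun_prop)
  have h1 : Tendsto (fun p : Matrix (Fin c) (Fin c) ℝ × (Fin c → ℝ) => ((CFC.sqrt p.1)⁻¹, p.2))
      (𝓝[{S | S.PosSemidef}] S ×ˢ 𝓝 u) (𝓝 ((CFC.sqrt S)⁻¹, u)) := by
    rw [nhds_prod_eq]
    exact ((hinv.tendsto.comp hsqrt).comp tendsto_fst).prodMk tendsto_snd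
  have h2 : Continuous fun p : Matrix (Fin c) (Fin c) ℝ × (Fin c → ℝ) => p.1.mulVec p.2 := by
    fun_prop
  exact h2.continuousAt.tendsto.comp h1

theorem measurable_whiten {Ω : Type*} [MeasurableSpace Ω] {S : Ω → Matrix (Fin c) (Fin c) ℝ}
    (hS : ∀ a b, Measurable fun ω => S ω a b) (hpos : ∀ ω, (S ω).PosSemidef)
    {u : Ω → Fin c → ℝ} (hu : ∀ a, Measurable fun ω => u ω a) (a : Fin c) :
    Measurable fun ω => whiten (S ω) (u ω) a := by
  have hsqrt : ∀ i j, Measurable fun ω => CFC.sqrt (S ω) i j := by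
    intro i j
    have hSm : Measurable fun ω => (fun a b => S ω a b : Fin c → Fin c → ℝ) :=
      measurable_pi_lambda _ fun a => measurable_pi_lambda _ fun b => hS a b
    have hcl : IsClosed {M : Fin c → Fin c → ℝ | (Matrix.of M).PosSemidef} :=
      isClosed_posSemidef.preimage (f := fun M : Fin c → Fin c → ℝ => Matrix.of M) continuous_id
    have hc : ContinuousOn (fun M : Fin c → Fin c → ℝ => CFC.sqrt (Matrix.of M) i j)
        {M | (Matrix.of M).PosSemidef} := by
      have h1 := continuousOn_matrix_sqrt (ι := Fin c)
      have h2 : Continuous fun M : Matrix (Fin c) (Fin c) ℝ => M i j := by fun_prop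
      exact h2.comp_continuousOn h1
    classical
    -- Continuity on a closed set gives measurability after extension by `0`; the values of `S`
    -- never leave that set.
    have hm := hc.measurable_piecewise (g := fun _ => (0 : ℝ)) continuousOn_const hcl.measurableSet
    have := hm.comp hSm
    convert this using 2 with ω
    rw [Function.comp_apply, Set.piecewise_eq_of_mem _ _ _ (by exact hpos ω)]
    rfl
  have hdet : ∀ {M : Ω → Matrix (Fin c) (Fin c) ℝ}, (∀ i j, Measurable fun ω => M ω i j) →
      Measurable fun ω => (M ω).det := by
    intro M hM
    simp only [Matrix.det_apply]
    refine Finset.measurable_sum _ fun σ _ => ?_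
    exact (Finset.measurable_prod _ fun i _ => hM _ _).const_smul _
  have hinv : ∀ i j, Measurable fun ω => (CFC.sqrt (S ω))⁻¹ i j := by
    intro i j
    simp only [Matrix.inv_def, Ring.inverse_eq_inv', Matrix.smul_apply, smul_eq_mul,
      Matrix.adjugate_apply]
    refine (hdet hsqrt).inv.mul (hdet fun k l => ?_)
    by_cases hk : k = j
    · subst hk; simp [Matrix.updateRow_self]
    · simpa [Matrix.updateRow_ne hk] using hsqrt k l
  simp only [whiten, Matrix.mulVec, dotProduct]
  exact Finset.measurable_sum _ fun b _ => (hinv a b).mul (hu b)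

instance : MeasurableSingletonClass ℤˣ where
  measurableSet_singleton u := by
    have h : ({u} : Set ℤˣ) = Units.val ⁻¹' {(u : ℤ)} := by
      ext v
      simp [Units.ext_iff]
    rw [h]
    exact comap_measurable Units.val (MeasurableSet.singleton _)

theorem measurable_sgn : Measurable sgn :=
  Measurable.ite (measurableSet_le measurable_const measurable_id) measurable_const
    measurable_const

theorem measurable_selStat {Ω : Type*} [MeasurableSpace Ω] (n : ℕ) (Ftr : Fin c → ℤˣ)
    {v : Ω → Fin c → ℝ} (hv : ∀ a, Measurable fun ω => v ω a) :
    Measurable fun ω => selStat n Ftr (v ω) := by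
  simp only [selStat]
  refine measurable_const.mul (Finset.measurable_sum _ fun a _ => ?_)
  refine (Measurable.mul (Measurable.ite ?_ measurable_const measurable_const) (hv a)).pow_const 2
  exact (measurable_sgn.comp (hv a)) (MeasurableSet.singleton (Ftr a))

/-- The selection jumps with `sgn`, so `selStat` is not treated by continuity. It is bounded above
by the full sum of squares (for the bootstrap) and below by one agreeing coordinate (for the
observed statistic). -/
theorem selStat_le (n : ℕ) (Ftr : Fin c → ℤˣ) (v : Fin c → ℝ) :
    selStat n Ftr v ≤ (n : ℝ) ^ 2 * ∑ a, v a ^ 2 := by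
  refine mul_le_mul_of_nonneg_left (Finset.sum_le_sum fun a _ => ?_) (sq_nonneg _)
  split_ifs
  · simp
  · simpa using sq_nonneg (v a)

theorem le_selStat (n : ℕ) (Ftr : Fin c → ℤˣ) (v : Fin c → ℝ) {a : Fin c}
    (ha : sgn (v a) = Ftr a) : (n : ℝ) ^ 2 * v a ^ 2 ≤ selStat n Ftr v := by
  refine mul_le_mul_of_nonneg_left ?_ (sq_nonneg _)
  refine le_trans ?_ (Finset.single_le_sum
    (f := fun a => ((if sgn (v a) = Ftr a then 1 else 0) * v a) ^ 2)
    (fun k _ => sq_nonneg _) (Finset.mem_univ a))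
  simp [ha]

theorem eventually_sgn_eq {r : ℝ} (hr : r ≠ 0) : ∀ᶠ x in 𝓝 r, sgn x = sgn r ∧ r ^ 2 / 2 < x ^ 2 := by
  have h2 : ∀ᶠ x in 𝓝 r, r ^ 2 / 2 < x ^ 2 := by
    have : ContinuousAt (fun x : ℝ => x ^ 2) r := by fun_prop
    exact continuousAt_const.eventually_lt this (by have := sq_pos_of_ne_zero hr; linarith)
  refine Filter.Eventually.and ?_ h2
  rcases lt_or_gt_of_ne hr with h | h
  · filter_upwards [eventually_lt_nhds h] with x hx
    simp [sgn, not_le.mpr h, not_le.mpr hx]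
  · filter_upwards [eventually_gt_nhds h] with x hx
    simp [sgn, h.le, hx.le]

/-- Near the population quantities, the selected statistic exceeds that of a small vector. -/
theorem exists_forall_selStat_lt {S₀ : Matrix (Fin c) (Fin c) ℝ} (hS₀ : S₀.PosDef)
    {u₀ : Fin c → ℝ} {Ftr : Fin c → ℤˣ} (h : SignAgreement Ftr S₀ u₀) :
    ∃ ε > 0, ∀ S : Matrix (Fin c) (Fin c) ℝ, S.PosSemidef → (∀ a b, |S a b - S₀ a b| < ε) →
      ∀ u, (∀ a, |u a - u₀ a| < ε) → ∀ v : Fin c → ℝ, (∀ a, |v a| < ε) → ∀ n : ℕ, 0 < n →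
        selStat n Ftr (whiten S v) < selStat n Ftr (whiten S u) := by
  obtain ⟨a, ha, hsgn⟩ := h
  set r := whiten S₀ u₀ a with hr
  have h1 : ∀ᶠ p in 𝓝[{S | S.PosSemidef}] S₀ ×ˢ 𝓝 u₀,
      sgn (whiten p.1 p.2 a) = sgn r ∧ r ^ 2 / 2 < whiten p.1 p.2 a ^ 2 :=
    (((continuous_apply a).continuousAt.tendsto).comp (tendsto_whiten hS₀ u₀)).eventually
      (eventually_sgn_eq ha)
  -- The level `r ^ 2 / 2` separates the two sides: the agreeing coordinate stays above it near
  -- `u₀`, the whole squared norm below it near `0`.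
  have h2 : ∀ᶠ p in 𝓝[{S | S.PosSemidef}] S₀ ×ˢ 𝓝 (0 : Fin c → ℝ),
      ∑ b, whiten p.1 p.2 b ^ 2 < r ^ 2 / 2 := by
    have hc : ContinuousAt (fun v : Fin c → ℝ => ∑ b, v b ^ 2) (whiten S₀ 0) := by
      refine (continuous_finsetSum _ fun b _ => ?_).continuousAt
      fun_prop
    refine (hc.tendsto.comp (tendsto_whiten hS₀ 0)).eventually (eventually_lt_nhds ?_)
    have := sq_pos_of_ne_zero ha
    simp only [whiten, Matrix.mulVec_zero]
    simpa using this
  obtain ⟨A, hA, V, hV, hAV⟩ := eventually_prod_iff.mp h1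
  obtain ⟨A', hA', V', hV', hAV'⟩ := eventually_prod_iff.mp h2
  have hAA := hA.and hA'
  rw [eventually_nhdsWithin_iff] at hAA
  -- Matrices are read as functions, so that the sup metric turns neighbourhoods into entrywise
  -- bounds.
  have hAA' : ∀ᶠ S : Fin c → Fin c → ℝ in 𝓝 (fun a b => S₀ a b), (Matrix.of S).PosSemidef →
      A (Matrix.of S) ∧ A' (Matrix.of S) := hAA
  obtain ⟨ε₁, hε₁, H₁⟩ := Metric.eventually_nhds_iff.mp hAA'
  obtain ⟨ε₂, hε₂, H₂⟩ := Metric.eventually_nhds_iff.mp hV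
  obtain ⟨ε₃, hε₃, H₃⟩ := Metric.eventually_nhds_iff.mp hV'
  refine ⟨min ε₁ (min ε₂ ε₃), by positivity, fun S hS hSS u hu v hv n hn => ?_⟩
  have hAS := H₁ (y := fun a b => S a b) (by
    refine (dist_pi_lt_iff hε₁).mpr fun a => (dist_pi_lt_iff hε₁).mpr fun b => ?_
    rw [Real.dist_eq]
    exact (hSS a b).trans_le (min_le_left _ _)) hS
  have hVu := H₂ (y := u) (by
    refine (dist_pi_lt_iff hε₂).mpr fun a => ?_
    rw [Real.dist_eq]
    exact (hu a).trans_le ((min_le_right _ _).trans (min_le_left _ _)))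
  have hVv := H₃ (y := v) (by
    refine (dist_pi_lt_iff hε₃).mpr fun a => ?_
    rw [Real.dist_eq, Pi.zero_apply, sub_zero]
    exact (hv a).trans_le ((min_le_right _ _).trans (min_le_right _ _)))
  have h3 := hAV hAS.1 hVu
  have h4 := hAV' hAS.2 hVv
  have hn' : (0 : ℝ) < (n : ℝ) ^ 2 := by positivity
  calc selStat n Ftr (whiten S v) ≤ (n : ℝ) ^ 2 * ∑ b, whiten S v b ^ 2 := selStat_le _ _ _
    _ < (n : ℝ) ^ 2 * whiten S u a ^ 2 := mul_lt_mul_of_pos_left (h4.trans h3.2) hn'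
    _ ≤ selStat n Ftr (whiten S u) := le_selStat _ _ _ (h3.1.trans hsgn.symm)

/-- The estimator is a nonnegative multiple of a sum of rank-one matrices `v vᵀ`. -/
theorem posSemidef_covEst {𝒲 : Type*} {n : ℕ} (h : Fin c → 𝒲 → 𝒲 → ℝ) (w' : Fin n → 𝒲) :
    (covEst h w').PosSemidef := by
  have h1 : covEst h w' = ((n : ℝ) ^ 2 * (((n.choose 2 : ℕ) : ℝ) ^ 2)⁻¹) •
      ∑ p : Fin n × Fin n with p.1 < p.2,
        Matrix.vecMulVec (fun a => h a (w' p.1) (w' p.2)) (star fun a => h a (w' p.1) (w' p.2)) := by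
    ext a b
    simp [covEst, sumPairs, Matrix.sum_apply, Matrix.vecMulVec_apply]
  rw [h1]
  exact (Matrix.posSemidef_sum _ fun p _ => Matrix.posSemidef_vecMulVec_self_star _).smul
    (by positivity)

end Whiten

/-! ### The bootstrap threshold -/

section Threshold

variable {B : ℕ}

/-- Replaces the infimum by a count. If enough values lie strictly below `x`, the largest of them is
an admissible level below `x`. The bounds on `α` make the set of levels nonempty and bounded below.
-/
theorem threshold_lt_iff {α : ℝ} (hα₀ : 0 < α) (hα₁ : α < 1) (T : Fin (B + 1) → ℝ) (x : ℝ) :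
    threshold α T < x ↔ 1 - α ≤ 1 / ((B : ℝ) + 1) * ∑ b, if T b < x then (1 : ℝ) else 0 := by
  have hB : (0 : ℝ) < 1 / ((B : ℝ) + 1) := by positivity
  have hbdd : BddBelow {τ : ℝ | 1 - α ≤ 1 / ((B : ℝ) + 1) * ∑ b, if T b ≤ τ then (1 : ℝ) else 0} := by
    refine ⟨Finset.univ.inf' Finset.univ_nonempty T, fun τ hτ => ?_⟩
    by_contra hlt
    rw [not_le, Finset.lt_inf'_iff] at hlt
    have : (∑ b, if T b ≤ τ then (1 : ℝ) else 0) = 0 :=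
      Finset.sum_eq_zero fun b hb => if_neg (not_le.mpr (hlt b hb))
    rw [Set.mem_ofPred_eq, this, mul_zero] at hτ
    linarith
  have hne : {τ : ℝ | 1 - α ≤ 1 / ((B : ℝ) + 1) * ∑ b, if T b ≤ τ then (1 : ℝ) else 0}.Nonempty := by
    refine ⟨Finset.univ.sup' Finset.univ_nonempty T, ?_⟩
    have : (∑ b, if T b ≤ Finset.univ.sup' Finset.univ_nonempty T then (1 : ℝ) else 0) = B + 1 := by
      rw [Finset.sum_congr rfl fun b hb => if_pos (Finset.le_sup' T hb)]
      simp
    rw [Set.mem_ofPred_eq, this, one_div_mul_cancel (by positivity)]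
    linarith
  rw [threshold, csInf_lt_iff hbdd hne]
  constructor
  · rintro ⟨τ, hτ, hlt⟩
    refine le_trans hτ (mul_le_mul_of_nonneg_left (Finset.sum_le_sum fun b _ => ?_) hB.le)
    split_ifs with h1 h2 h2
    · rfl
    · exact absurd (h1.trans_lt hlt) h2
    · exact zero_le_one
    · rfl
  · intro hx
    have hne' : (Finset.univ.filter fun b => T b < x).Nonempty := by
      by_contra hemp
      rw [Finset.not_nonempty_iff_eq_empty, Finset.filter_eq_empty_iff] at hemp
      rw [Finset.sum_eq_zero fun b hb => if_neg (hemp hb), mul_zero] at hx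
      linarith
    refine ⟨(Finset.univ.filter fun b => T b < x).sup' hne' T, ?_, ?_⟩
    · refine le_trans hx (mul_le_mul_of_nonneg_left (Finset.sum_le_sum fun b _ => ?_) hB.le)
      split_ifs with h1 h2 h2
      · rfl
      · exact absurd (Finset.le_sup' T (by simp [h1])) h2
      · exact zero_le_one
      · rfl
    · rw [Finset.sup'_lt_iff]
      intro b hb
      exact (Finset.mem_filter.mp hb).2

/-- At most `α (B + 1)` of the values exceed the threshold. -/
theorem sum_threshold_lt_le {α : ℝ} (hα₀ : 0 < α) (hα₁ : α < 1) (T : Fin (B + 1) → ℝ) :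
    (∑ b, if threshold α T < T b then (1 : ℝ) else 0) ≤ α * ((B : ℝ) + 1) := by
  have hB : (0 : ℝ) < (B : ℝ) + 1 := by positivity
  rcases (Finset.univ.filter fun b => threshold α T < T b).eq_empty_or_nonempty with h | h
  · rw [Finset.filter_eq_empty_iff] at h
    rw [Finset.sum_eq_zero fun b hb => if_neg (h hb)]
    positivity
  -- Let `T j` be the smallest value above the threshold. At least `(1 - α) (B + 1)` values are
  -- below `T j`, and by minimality none of these exceeds the threshold.
  · obtain ⟨j, hj, hmin⟩ := Finset.exists_min_image _ T h
    have h1 := (threshold_lt_iff hα₀ hα₁ T (T j)).mp (Finset.mem_filter.mp hj).2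
    rw [one_div, ← div_eq_inv_mul, le_div_iff₀ hB] at h1
    have h2 : (∑ b, if T b < T j then (1 : ℝ) else 0) +
        (∑ b, if threshold α T < T b then (1 : ℝ) else 0) ≤ ∑ _b : Fin (B + 1), (1 : ℝ) := by
      rw [← Finset.sum_add_distrib]
      refine Finset.sum_le_sum fun b _ => ?_
      split_ifs with h3 h4
      · exact absurd h3 (not_lt.mpr (hmin b (by simp [h4])))
      all_goals norm_num
    simp at h2
    simp at h1 ⊢
    linarith

/-- Exactly `B` of the `B + 1` values lie below the strict maximum, and `B ≥ (1 - α) (B + 1)` is the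
condition `1 ≤ α (B + 1)`. -/
theorem threshold_lt_of_forall_lt {α : ℝ} (hα₀ : 0 < α) (hα₁ : α < 1)
    (hB : 1 ≤ α * ((B : ℝ) + 1)) {Tb : Fin B → ℝ} {t : ℝ} (h : ∀ b, Tb b < t) :
    threshold α (Fin.snoc (α := fun _ => ℝ) Tb t) < t := by
  rw [threshold_lt_iff hα₀ hα₁, Fin.sum_univ_castSucc]
  have hB' : (0 : ℝ) < (B : ℝ) + 1 := by positivity
  simp only [Fin.snoc_castSucc, Fin.snoc_last, h, if_true, lt_irrefl, if_false]
  rw [one_div, ← div_eq_inv_mul, le_div_iff₀ hB']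
  simp
  linarith

theorem threshold_comp_perm (α : ℝ) (T : Fin (B + 1) → ℝ) (σ : Equiv.Perm (Fin (B + 1))) :
    threshold α (T ∘ σ) = threshold α T := by
  simp only [threshold, Function.comp_apply]
  congr 1
  ext τ
  rw [Set.mem_ofPred_eq, Set.mem_ofPred_eq,
    Equiv.sum_comp σ fun b => if T b ≤ τ then (1 : ℝ) else 0]

theorem measurableSet_threshold_lt {Ω : Type*} [MeasurableSpace Ω] {α : ℝ} (hα₀ : 0 < α)
    (hα₁ : α < 1) {T : Ω → Fin (B + 1) → ℝ} (hT : ∀ b, Measurable fun ω => T ω b) {x : Ω → ℝ}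
    (hx : Measurable x) : MeasurableSet {ω | threshold α (T ω) < x ω} := by
  simp only [threshold_lt_iff hα₀ hα₁]
  refine measurableSet_le measurable_const (measurable_const.mul ?_)
  exact Finset.measurable_sum _ fun b _ =>
    Measurable.ite (measurableSet_lt (hT b) hx) measurable_const measurable_const

end Threshold

/-! ### The law of the signs -/

instance : IsProbabilityMeasure rademacher := by
  constructor
  simp [rademacher, ENNReal.inv_two_add_inv_two]

instance (B n : ℕ) : IsProbabilityMeasure (signLaw B n) := by
  unfold signLaw; infer_instance

theorem rademacher_singleton (u : ℤˣ) : rademacher {u} = 2⁻¹ := by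
  rcases Int.units_eq_one_or u with rfl | rfl <;> simp [rademacher]

theorem signLaw_singleton {B n : ℕ} (ε : Fin B → Fin n → ℤˣ) :
    (signLaw B n).real {ε} = (Fintype.card (Fin B → Fin n → ℤˣ) : ℝ)⁻¹ := by
  simp [signLaw, measureReal_def, Measure.pi_singleton, rademacher_singleton]

theorem measureReal_prod_fintype {Ω E : Type*} [MeasurableSpace Ω] [MeasurableSpace E] [Fintype E]
    [MeasurableSingletonClass E] (μ : Measure Ω) (ν : Measure E) [IsFiniteMeasure μ]
    [IsFiniteMeasure ν] {A : E → Set Ω} (hA : ∀ e, MeasurableSet (A e)) :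
    (μ.prod ν).real {p | p.1 ∈ A p.2} = ∑ e, ν.real {e} * μ.real (A e) := by
  have h : {p : Ω × E | p.1 ∈ A p.2} = ⋃ e, A e ×ˢ {e} := by
    ext p
    simp
  rw [h, measureReal_iUnion_fintype _ fun e => (hA e).prod (MeasurableSet.singleton e)]
  · simp [measureReal_prod_prod, mul_comm]
  · intro e e' hee
    exact Set.disjoint_left.mpr fun p hp hp' => hee (by simp_all)

/-- Puts the observed statistic on the same footing as the bootstrap ones, as the identity of the
group of sign vectors. -/
theorem uStat_eq_wildUStat {𝒲 : Type*} {c n : ℕ} (h : Fin c → 𝒲 → 𝒲 → ℝ) (w : Fin n → 𝒲) :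
    uStat h w = wildUStat h w 1 := by
  ext a
  simp [uStat, wildUStat]

section Measurability

variable {Ω 𝒲 : Type*} [MeasurableSpace Ω] {c n : ℕ} {h : Fin c → 𝒲 → 𝒲 → ℝ}

theorem measurable_sumPairs {f : Ω → Fin n → Fin n → ℝ}
    (hf : ∀ i j, Measurable fun ω => f ω i j) : Measurable fun ω => sumPairs n (f ω) :=
  Finset.measurable_sum _ fun _ _ => hf _ _

theorem measurable_wildUStat {w : Ω → Fin n → 𝒲}
    (hw : ∀ a i j, Measurable fun ω => h a (w ω i) (w ω j)) (ε : Fin n → ℤˣ) (a : Fin c) :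
    Measurable fun ω => wildUStat h (w ω) ε a :=
  (measurable_sumPairs fun i j => (hw a i j).const_mul _).const_mul _

theorem measurable_covEst {w : Ω → Fin n → 𝒲}
    (hw : ∀ a i j, Measurable fun ω => h a (w ω i) (w ω j)) (a b : Fin c) :
    Measurable fun ω => covEst h (w ω) a b :=
  (measurable_sumPairs fun i j => (hw a i j).mul (hw b i j)).const_mul _

end Measurability

/-! ### Level -/

/-- The test has level `α` if flipping signs of the observations is a symmetry of their law that
does not change the simulated null sample. -/
theorem measureReal_rejects_le {Ω 𝒲 : Type*} [MeasurableSpace Ω] (μ : Measure Ω)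
    [IsProbabilityMeasure μ] {B c n : ℕ} {α : ℝ} (hα₀ : 0 < α) (hα₁ : α < 1) (Ftr : Fin c → ℤˣ)
    (h : Fin c → 𝒲 → 𝒲 → ℝ) (w w' : Ω → Fin n → 𝒲)
    (hw : ∀ a i j, Measurable fun ω => h a (w ω i) (w ω j))
    (hw' : ∀ a i j, Measurable fun ω => h a (w' ω i) (w' ω j))
    (φ : (Fin n → ℤˣ) → Ω → Ω) (hφ : ∀ δ, MeasurePreserving (φ δ) μ μ)
    (hφw : ∀ δ ω a i j, i ≠ j → h a (w (φ δ ω) i) (w (φ δ ω) j) =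
      ((δ i : ℤ) : ℝ) * ((δ j : ℤ) : ℝ) * h a (w ω i) (w ω j))
    (hφw' : ∀ δ ω, w' (φ δ ω) = w' ω) :
    (μ.prod (signLaw B n)).real
      {ω : Ω × (Fin B → Fin n → ℤˣ) | Rejects α Ftr h (w ω.1) (w' ω.1) ω.2} ≤ α := by
  let G := Fin n → ℤˣ
  let t : Ω → G → ℝ := fun ω δ => selStat n Ftr (whiten (covEst h (w' ω)) (wildUStat h (w ω) δ))
  have ht : ∀ δ, Measurable fun ω => t ω δ := fun δ => measurable_selStat n Ftr fun a =>
    measurable_whiten (measurable_covEst hw') (fun ω => posSemidef_covEst _ _)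
      (measurable_wildUStat hw δ) a
  -- Flipping the observations by `δ` translates the signs by `δ`; the whitening matrix does not
  -- move, because `w'` is invariant.
  have htφ : ∀ δ ε ω, t (φ δ ω) ε = t ω (δ * ε) := by
    intro δ ε ω
    have h1 : wildUStat h (w (φ δ ω)) ε = wildUStat h (w ω) (δ * ε) := by
      ext a
      simp only [wildUStat, sumPairs]
      congr 1
      refine Finset.sum_congr rfl fun p hp => ?_
      rw [hφw δ ω a p.1 p.2 (Finset.mem_filter.mp hp).2.ne]
      have h2 : ∀ i, (((δ * ε) i : ℤ) : ℝ) = ((δ i : ℤ) : ℝ) * ((ε i : ℤ) : ℝ) := fun i => by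
        rw [show (δ * ε) i = δ i * ε i from rfl, Units.val_mul, Int.cast_mul]
      rw [h2, h2]
      ring
    simp only [t, hφw', h1]
  -- The event that the `j`-th of `B + 1` statistics with fixed sign vectors `ε` exceeds their
  -- threshold.
  let q : (Fin (B + 1) → G) → Fin (B + 1) → Set Ω := fun ε j =>
    {ω | threshold α (fun b => t ω (ε b)) < t ω (ε j)}
  have hq : ∀ ε j, MeasurableSet (q ε j) := fun ε j =>
    measurableSet_threshold_lt hα₀ hα₁ (fun b => ht (ε b)) (ht (ε j))
  let sn : (Fin B → G) → G → Fin (B + 1) → G := fun ε δ => Fin.snoc (α := fun _ => G) ε δ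
  have hsn : ∀ ε δ ω, (fun b => t ω (sn ε δ b)) =
      Fin.snoc (α := fun _ => ℝ) (fun b => t ω (ε b)) (t ω δ) := by
    intro ε δ ω
    ext b
    refine Fin.lastCases ?_ (fun b => ?_) b <;> simp [sn]
  have hRej : {ω : Ω × (Fin B → Fin n → ℤˣ) | Rejects α Ftr h (w ω.1) (w' ω.1) ω.2} =
      {p | p.1 ∈ q (sn p.2 1) (Fin.last B)} := by
    ext p
    simp only [Set.mem_ofPred_eq, q, hsn]
    simp only [Rejects, uStat_eq_wildUStat, t, sn, Fin.snoc_last]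
  have hflip : ∀ ε δ, μ.real (q (sn ε 1) (Fin.last B)) =
      μ.real (q (sn (fun b => δ * ε b) δ) (Fin.last B)) := by
    intro ε δ
    rw [measureReal_def, ← (hφ δ).measure_preimage (hq _ _).nullMeasurableSet, ← measureReal_def]
    congr 1
    ext ω
    simp only [Set.mem_preimage, Set.mem_ofPred_eq, q, hsn]
    simp [htφ, sn]
  set K : ℝ := ∑ ε : Fin B → G, μ.real (q (sn ε 1) (Fin.last B)) with hK
  -- Translation by `δ` permutes the bootstrap signs, so after summing over them the last sign
  -- vector may be any `δ` in place of `1`.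
  have hδ : ∀ δ, ∑ ε : Fin B → G, μ.real (q (sn ε δ) (Fin.last B)) = K := by
    intro δ
    rw [hK, Finset.sum_congr rfl fun ε _ => hflip ε δ]
    exact (Equiv.sum_comp (Equiv.piCongrRight fun _ : Fin B => Equiv.mulLeft δ)
      fun ε => μ.real (q (sn ε δ) (Fin.last B))).symm
  have hlast : ∑ ε : Fin (B + 1) → G, μ.real (q ε (Fin.last B)) = Fintype.card G * K := by
    rw [← Equiv.sum_comp (Fin.snocEquiv fun _ : Fin (B + 1) => G), Fintype.sum_prod_type]
    refine (Finset.sum_congr rfl fun δ _ => hδ δ).trans ?_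
    simp
  -- Exchangeability: swapping `j` with the last position permutes the sign families and leaves the
  -- threshold fixed.
  have hperm : ∀ j, ∑ ε : Fin (B + 1) → G, μ.real (q ε j) =
      ∑ ε : Fin (B + 1) → G, μ.real (q ε (Fin.last B)) := by
    intro j
    rw [← Equiv.sum_comp (Equiv.arrowCongr (Equiv.swap j (Fin.last B)) (Equiv.refl G))
      fun ε => μ.real (q ε (Fin.last B))]
    refine Finset.sum_congr rfl fun ε _ => ?_
    congr 1
    ext ω
    have := threshold_comp_perm α (fun b => t ω (ε b)) (Equiv.swap j (Fin.last B))
    simp only [Set.mem_ofPred_eq, q, Equiv.arrowCongr_apply, Equiv.coe_refl, Function.comp_apply,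
      Equiv.symm_swap, id, Equiv.swap_apply_right]
    rw [← this]
    rfl
  have hsum : ∀ ε : Fin (B + 1) → G, ∑ j, μ.real (q ε j) ≤ α * ((B : ℝ) + 1) := by
    intro ε
    have h1 : ∀ j, μ.real (q ε j) = ∫ ω, (if threshold α (fun b => t ω (ε b)) < t ω (ε j)
        then (1 : ℝ) else 0) ∂μ := by
      intro j
      rw [← integral_indicator_one (hq ε j)]
      refine integral_congr_ae (Eventually.of_forall fun ω => ?_)
      simp [Set.indicator_apply, q]
    have hint : ∀ j, Integrable (fun ω => if threshold α (fun b => t ω (ε b)) < t ω (ε j)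
        then (1 : ℝ) else 0) μ := by
      intro j
      refine Integrable.of_bound
        (Measurable.ite (hq ε j) measurable_const measurable_const).aestronglyMeasurable 1
        (Eventually.of_forall fun ω => ?_)
      split_ifs <;> simp
    rw [Finset.sum_congr rfl fun j _ => h1 j, ← integral_finsetSum _ fun j _ => hint j]
    refine (integral_mono (integrable_finsetSum _ fun j _ => hint j) (integrable_const _)
      fun ω => sum_threshold_lt_le hα₀ hα₁ fun b => t ω (ε b)).trans ?_
    simp
  -- Double counting over positions and sign families: each position contributes the same total, and
  -- each family at most `α (B + 1)`.
  have hfinal : ((B : ℝ) + 1) * (Fintype.card G * K) ≤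
      Fintype.card (Fin (B + 1) → G) * (α * ((B : ℝ) + 1)) := by
    calc ((B : ℝ) + 1) * (Fintype.card G * K)
        = ∑ j : Fin (B + 1), ∑ ε : Fin (B + 1) → G, μ.real (q ε j) := by
          rw [Finset.sum_congr rfl fun j _ => (hperm j).trans hlast]
          simp
      _ = ∑ ε : Fin (B + 1) → G, ∑ j, μ.real (q ε j) := Finset.sum_comm
      _ ≤ ∑ _ε : Fin (B + 1) → G, α * ((B : ℝ) + 1) := Finset.sum_le_sum fun ε _ => hsum ε
      _ = _ := by simp
  rw [hRej, measureReal_prod_fintype _ _ (A := fun e => q (sn e 1) (Fin.last B)) fun e => hq _ _]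
  simp only [signLaw_singleton, ← Finset.mul_sum]
  rw [inv_mul_le_iff₀ (by positivity)]
  have hG : (0 : ℝ) < Fintype.card G := by exact_mod_cast Fintype.card_pos
  have hB : (0 : ℝ) < (B : ℝ) + 1 := by positivity
  have hcard : (Fintype.card (Fin (B + 1) → G) : ℝ) =
      Fintype.card G * Fintype.card (Fin B → G) := by
    simp [Fintype.card_pi, pow_succ, mul_comm]
  rw [hcard] at hfinal
  refine le_of_mul_le_mul_left ?_ (mul_pos hB hG)
  calc ((B : ℝ) + 1) * Fintype.card G * K = ((B : ℝ) + 1) * (Fintype.card G * K) := by ring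
    _ ≤ _ := hfinal
    _ = _ := by ring

/-! ### Resampling from a pool of observations -/

section Pool

variable {𝒲 S : Type*} [MeasurableSpace 𝒲] [Fintype S]

/-- For each of the `n` elements of the simulated null sample and each slot `s : S`, a uniformly
distributed index of the pool. -/
def slotLaw (S : Type*) [Fintype S] (n : ℕ) : Measure (Fin n → S → Fin n × Fin 2) :=
  Measure.pi fun _ => Measure.pi fun _ => uniformOn Set.univ

/-- The sample assembled by `Φ` from the slots filled according to `J`. -/
def nullSample (Φ : (S → 𝒲 × Fin 2) → 𝒲) {n : ℕ} (d : Fin n → 𝒲)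
    (J : Fin n → S → Fin n × Fin 2) (i : Fin n) : 𝒲 :=
  Φ fun s => (d (J i s).1, (J i s).2)

instance {α : Type*} [Fintype α] [MeasurableSpace α] [MeasurableSingletonClass α] :
    IsFiniteMeasure (uniformOn (Set.univ : Set α)) := by
  rcases isEmpty_or_nonempty α with h | h
  · rw [Set.univ_eq_empty_iff.mpr h, uniformOn_empty_meas]
    infer_instance
  · have := isProbabilityMeasure_uniformOn (Ω := α) Set.finite_univ Set.univ_nonempty
    infer_instance

instance {α : Type*} [Fintype α] [Nonempty α] [MeasurableSpace α] [MeasurableSingletonClass α] :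
    IsProbabilityMeasure (uniformOn (Set.univ : Set α)) :=
  isProbabilityMeasure_uniformOn Set.finite_univ Set.univ_nonempty

/-- For `n = 0` the pool is empty and its `uniformOn` measure is zero, but the product over no
indices is still a probability measure. -/
instance (n : ℕ) : IsProbabilityMeasure (slotLaw S n) := by
  unfold slotLaw
  rcases Nat.eq_zero_or_pos n with rfl | hn
  · rw [Measure.pi_of_empty]
    infer_instance
  · have : NeZero n := ⟨hn.ne'⟩
    infer_instance

theorem measurePreserving_uniformOn_univ {α : Type*} [Fintype α] [MeasurableSpace α]
    [MeasurableSingletonClass α] {f : α → α} (hf : f.Bijective) :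
    MeasurePreserving f (uniformOn Set.univ) (uniformOn Set.univ) := by
  refine ⟨measurable_of_finite f, ?_⟩
  ext s hs
  rw [Measure.map_apply (measurable_of_finite f) hs, uniformOn_univ, uniformOn_univ,
    Measure.count_apply (measurable_of_finite f hs), Measure.count_apply hs,
    Set.encard_preimage_of_bijective hf]

theorem measurable_draw {n : ℕ} :
    Measurable fun p : (Fin n → 𝒲) × (Fin n × Fin 2) => (p.1 p.2.1, p.2.2) :=
  measurable_from_prod_countable_left fun r => (measurable_pi_apply r.1).prodMk
    (measurable_const (a := r.2))

omit [Fintype S] in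
theorem measurable_nullSample {Φ : (S → 𝒲 × Fin 2) → 𝒲} (hΦ : Measurable Φ) {n : ℕ} (i : Fin n) :
    Measurable fun ω : (Fin n → 𝒲) × (Fin n → S → Fin n × Fin 2) => nullSample Φ ω.1 ω.2 i := by
  refine hΦ.comp (measurable_pi_lambda _ fun s => ?_)
  have h1 : Measurable fun ω : (Fin n → 𝒲) × (Fin n → S → Fin n × Fin 2) => (ω.1, ω.2 i s) := by
    fun_prop
  exact measurable_draw.comp h1

/-- The probability of rejection, for a sample of law `W` and a null sample assembled by `Φ`. -/
def poolRejectProb {c : ℕ} (B : ℕ) (α : ℝ) (Ftr : Fin c → ℤˣ) (h : Fin c → 𝒲 → 𝒲 → ℝ)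
    (W : Measure 𝒲) (Φ : (S → 𝒲 × Fin 2) → 𝒲) (n : ℕ) : ℝ :=
  (((Measure.pi fun _ : Fin n => W).prod (slotLaw S n)).prod (signLaw B n)).real
    {ω | Rejects α Ftr h ω.1.1 (nullSample Φ ω.1.1 ω.1.2) ω.2}

theorem measurable_core_apply {Ω : Type*} [MeasurableSpace Ω] {h : 𝒲 → 𝒲 → ℝ}
    (hh : Measurable fun p : 𝒲 × 𝒲 => h p.1 p.2) {f g : Ω → 𝒲} (hf : Measurable f)
    (hg : Measurable g) : Measurable fun ω => h (f ω) (g ω) :=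
  hh.comp (hf.prodMk hg)

/-- `τ` is the flip of one observation and `σ s` the compensating relabelling of the two entries as
seen from slot `s`. By `hσ`, doing both leaves the assembled null observation unchanged. The
relabelling may depend on the slot because HSIC flips only the `x`-entries. -/
theorem poolRejectProb_le {c : ℕ} (B : ℕ) {α : ℝ} (hα₀ : 0 < α) (hα₁ : α < 1) (Ftr : Fin c → ℤˣ)
    {h : Fin c → 𝒲 → 𝒲 → ℝ} (hh : ∀ a, Measurable fun p : 𝒲 × 𝒲 => h a p.1 p.2)
    {W : Measure 𝒲} [IsProbabilityMeasure W] {Φ : (S → 𝒲 × Fin 2) → 𝒲} (hΦ : Measurable Φ)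
    {τ : 𝒲 → 𝒲} (hτ : MeasurePreserving τ W W)
    (hτl : ∀ a w w', h a (τ w) w' = -h a w w') (hτr : ∀ a w w', h a w (τ w') = -h a w w')
    (σ : S → Equiv.Perm (Fin 2))
    (hσ : ∀ (u v : S → 𝒲 × Fin 2), (∀ s, v s = u s ∨ v s = (τ (u s).1, σ s (u s).2)) → Φ v = Φ u)
    (n : ℕ) : poolRejectProb B α Ftr h W Φ n ≤ α := by
  -- Only indices that point to flipped observations are relabelled; the observation index is kept,
  -- which makes `e δ s` injective.
  let e : (Fin n → ℤˣ) → S → Fin n × Fin 2 → Fin n × Fin 2 := fun δ s r =>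
    if δ r.1 = 1 then r else (r.1, σ s r.2)
  let φ : (Fin n → ℤˣ) → (Fin n → 𝒲) × (Fin n → S → Fin n × Fin 2) →
      (Fin n → 𝒲) × (Fin n → S → Fin n × Fin 2) := fun δ ω =>
    (fun i => (if δ i = 1 then id else τ) (ω.1 i), fun i s => e δ s (ω.2 i s))
  have he : ∀ δ s, (e δ s).Bijective := by
    intro δ s
    rw [Finite.injective_iff_bijective.symm]
    rintro ⟨k, r⟩ ⟨k', r'⟩ hkr
    simp only [e] at hkr
    split_ifs at hkr <;> simp_all
  have hφ : ∀ δ, MeasurePreserving (φ δ) ((Measure.pi fun _ : Fin n => W).prod (slotLaw S n))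
      ((Measure.pi fun _ : Fin n => W).prod (slotLaw S n)) := by
    intro δ
    have h1 : MeasurePreserving (fun (d : Fin n → 𝒲) i => (if δ i = 1 then id else τ) (d i))
        (Measure.pi fun _ => W) (Measure.pi fun _ => W) := by
      refine measurePreserving_pi (fun _ => W) (fun _ => W) fun i => ?_
      split_ifs
      · exact MeasurePreserving.id W
      · exact hτ
    have h2 : MeasurePreserving (fun (J : Fin n → S → Fin n × Fin 2) i s => e δ s (J i s))
        (slotLaw S n) (slotLaw S n) :=
      measurePreserving_pi _ _ fun i => measurePreserving_pi _ _ fun s =>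
        measurePreserving_uniformOn_univ (he δ s)
    exact h1.prod h2
  unfold poolRejectProb
  refine measureReal_rejects_le ((Measure.pi fun _ : Fin n => W).prod (slotLaw S n)) hα₀ hα₁ Ftr h
    (fun ω => ω.1) (fun ω => nullSample Φ ω.1 ω.2) (fun a i j => ?_) (fun a i j => ?_) φ hφ
    (fun δ ω a i j _ => ?_) (fun δ ω => ?_)
  · exact measurable_core_apply (hh a) (by fun_prop) (by fun_prop)
  · exact measurable_core_apply (hh a) (measurable_nullSample hΦ i) (measurable_nullSample hΦ j)
  · rcases Int.units_eq_one_or (δ i) with hi | hi <;>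
      rcases Int.units_eq_one_or (δ j) with hj | hj <;> simp [φ, hi, hj, hτl, hτr]
  · ext1 i
    refine hσ _ _ fun s => ?_
    rcases Int.units_eq_one_or (δ (ω.2 i s).1) with hi | hi <;> simp [φ, e, hi]

end Pool

/-! ### Second moments of averages over pairs -/

theorem card_filter_fst_lt_snd (n : ℕ) :
    (Finset.univ.filter fun p : Fin n × Fin n => p.1 < p.2).card = n.choose 2 := by
  rw [Finset.card_filter, Fintype.sum_prod_type_right]
  have h : ∀ j : Fin n, (∑ i : Fin n, if i < j then 1 else 0) = (j : ℕ) := by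
    intro j
    rw [← Finset.card_filter, ← Fin.card_Iio]
    congr 1
    ext i
    simp
  rw [Finset.sum_congr rfl fun j _ => h j, Fin.sum_univ_eq_sum_range fun i => i,
    Finset.sum_range_id, Nat.choose_two_right]

/-- The average over pairs `i < j`. -/
def avgPairs (n : ℕ) (f : Fin n → Fin n → ℝ) : ℝ := ((n.choose 2 : ℕ) : ℝ)⁻¹ * sumPairs n f

theorem avgPairs_sub_const {n : ℕ} (hn : 2 ≤ n) (f : Fin n → Fin n → ℝ) (m : ℝ) :
    avgPairs n (fun i j => f i j - m) = avgPairs n f - m := by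
  have hN : ((n.choose 2 : ℕ) : ℝ) ≠ 0 := by exact_mod_cast (Nat.choose_pos hn).ne'
  simp only [avgPairs, sumPairs, Finset.sum_sub_distrib, Finset.sum_const,
    card_filter_fst_lt_snd, nsmul_eq_mul]
  field_simp

/-- Each of the four possible coincidences fixes one index of `q` and leaves `n` choices for the
other. -/
theorem sum_ite_shared_index_le {n : ℕ} (p : Fin n × Fin n) :
    (∑ q : Fin n × Fin n, if q.1 = p.1 ∨ q.1 = p.2 ∨ q.2 = p.1 ∨ q.2 = p.2 then (1 : ℝ) else 0)
      ≤ 4 * n := by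
  have h1 : ∀ a : Fin n, (∑ q : Fin n × Fin n, if q.1 = a then (1 : ℝ) else 0) = n := by
    intro a
    rw [Fintype.sum_prod_type_right]
    simp
  have h2 : ∀ a : Fin n, (∑ q : Fin n × Fin n, if q.2 = a then (1 : ℝ) else 0) = n := by
    intro a
    rw [Fintype.sum_prod_type]
    simp
  have h3 : ∀ (a b c d : Prop) [Decidable a] [Decidable b] [Decidable c] [Decidable d],
      (if a ∨ b ∨ c ∨ d then (1 : ℝ) else 0) ≤ (if a then (1 : ℝ) else 0) +
        (if b then (1 : ℝ) else 0) + (if c then (1 : ℝ) else 0) + (if d then (1 : ℝ) else 0) := by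
    intro a b c d _ _ _ _
    by_cases ha : a <;> by_cases hb : b <;> by_cases hc : c <;> by_cases hd : d <;>
      simp only [ha, hb, hc, hd] <;> norm_num
  calc _ ≤ ∑ q : Fin n × Fin n, ((if q.1 = p.1 then (1 : ℝ) else 0) +
        (if q.1 = p.2 then (1 : ℝ) else 0) + (if q.2 = p.1 then (1 : ℝ) else 0) +
        (if q.2 = p.2 then (1 : ℝ) else 0)) := Finset.sum_le_sum fun q _ => h3 _ _ _ _
    _ = _ := by
        simp only [Finset.sum_add_distrib, h1, h2]
        ring

/-- The second moment of an average over pairs, if products of terms without common indices have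
small mean. -/
theorem integral_avgPairs_sq_le {Ω : Type*} [MeasurableSpace Ω] (μ : Measure Ω)
    [IsProbabilityMeasure μ] {n : ℕ} (hn : 2 ≤ n) {X : Ω → Fin n → Fin n → ℝ} {C η : ℝ}
    (hη : 0 ≤ η) (hX : ∀ i j, Measurable fun ω => X ω i j) (hC : ∀ ω i j, |X ω i j| ≤ C)
    (hdisj : ∀ i j k l, i ≠ j → k ≠ l → i ≠ k → i ≠ l → j ≠ k → j ≠ l →
      |∫ ω, X ω i j * X ω k l ∂μ| ≤ η) :
    Integrable (fun ω => avgPairs n (X ω) ^ 2) μ ∧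
      ∫ ω, avgPairs n (X ω) ^ 2 ∂μ ≤ η + C ^ 2 * (4 * n / (n.choose 2 : ℕ)) := by
  set N : ℝ := ((n.choose 2 : ℕ) : ℝ) with hN
  have hNpos : 0 < N := by rw [hN]; exact_mod_cast Nat.choose_pos hn
  have hC2 : ∀ ω i j k l, |X ω i j * X ω k l| ≤ C ^ 2 := by
    intro ω i j k l
    rw [abs_mul, sq]
    exact mul_le_mul (hC _ _ _) (hC _ _ _) (abs_nonneg _) ((abs_nonneg _).trans (hC ω i j))
  have hint : ∀ i j k l, Integrable (fun ω => X ω i j * X ω k l) μ := fun i j k l =>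
    Integrable.of_bound ((hX i j).mul (hX k l)).aestronglyMeasurable (C ^ 2)
      (Eventually.of_forall fun ω => hC2 ω i j k l)
  have hexp : ∀ ω, avgPairs n (X ω) ^ 2 = (N ^ 2)⁻¹ * ∑ p : Fin n × Fin n with p.1 < p.2,
      ∑ q : Fin n × Fin n with q.1 < q.2, X ω p.1 p.2 * X ω q.1 q.2 := by
    intro ω
    rw [avgPairs, mul_pow, sumPairs, sq (Finset.sum _ _), Finset.sum_mul_sum, ← inv_pow]
  -- For fixed `p`, pairs `q` disjoint from `p` contribute at most `η` each, and the at most `4 n`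
  -- others at most `C ^ 2` each.
  have hbound : ∀ p ∈ Finset.univ.filter (fun p : Fin n × Fin n => p.1 < p.2),
      ∑ q : Fin n × Fin n with q.1 < q.2, ∫ ω, X ω p.1 p.2 * X ω q.1 q.2 ∂μ ≤
        N * η + C ^ 2 * (4 * n) := by
    intro p hp
    have hp' := (Finset.mem_filter.mp hp).2
    calc _ ≤ ∑ q : Fin n × Fin n with q.1 < q.2, (η + C ^ 2 *
          (if q.1 = p.1 ∨ q.1 = p.2 ∨ q.2 = p.1 ∨ q.2 = p.2 then (1 : ℝ) else 0)) := by
          refine Finset.sum_le_sum fun q hq => ?_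
          have hq' := (Finset.mem_filter.mp hq).2
          split_ifs with hs
          · have : ∫ ω, X ω p.1 p.2 * X ω q.1 q.2 ∂μ ≤ ∫ _ω, C ^ 2 ∂μ :=
              integral_mono (hint _ _ _ _) (integrable_const _) fun ω =>
                (le_abs_self _).trans (hC2 ω _ _ _ _)
            simp at this
            linarith
          · push Not at hs
            rw [mul_zero, add_zero]
            exact (le_abs_self _).trans (hdisj _ _ _ _ hp'.ne hq'.ne hs.1.symm hs.2.2.1.symm
              hs.2.1.symm hs.2.2.2.symm)
      _ = N * η + C ^ 2 * ∑ q : Fin n × Fin n with q.1 < q.2,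
          (if q.1 = p.1 ∨ q.1 = p.2 ∨ q.2 = p.1 ∨ q.2 = p.2 then (1 : ℝ) else 0) := by
          rw [Finset.sum_add_distrib, Finset.sum_const, card_filter_fst_lt_snd, nsmul_eq_mul,
            Finset.mul_sum]
      _ ≤ _ := by
          refine add_le_add le_rfl (mul_le_mul_of_nonneg_left ?_ (sq_nonneg C))
          refine le_trans ?_ (sum_ite_shared_index_le p)
          refine Finset.sum_le_sum_of_subset_of_nonneg (Finset.filter_subset _ _) fun q _ _ => ?_
          split_ifs <;> norm_num
  have hsumint : ∀ p : Fin n × Fin n, Integrable (fun ω => ∑ q : Fin n × Fin n with q.1 < q.2,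
      X ω p.1 p.2 * X ω q.1 q.2) μ := fun p => integrable_finsetSum _ fun q _ => hint _ _ _ _
  simp only [hexp]
  refine ⟨(integrable_finsetSum _ fun p _ => hsumint p).const_mul _, ?_⟩
  rw [integral_const_mul, integral_finsetSum _ fun p _ => hsumint p]
  rw [Finset.sum_congr rfl fun p _ => integral_finsetSum _ fun q _ => hint p.1 p.2 q.1 q.2]
  calc _ ≤ (N ^ 2)⁻¹ * ∑ _p : Fin n × Fin n with _p.1 < _p.2, (N * η + C ^ 2 * (4 * n)) := by
        gcongr with p hp
        exact hbound p hp
    _ = _ := by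
        rw [Finset.sum_const, card_filter_fst_lt_snd, nsmul_eq_mul, ← hN]
        field_simp

theorem tendsto_div_choose_two : Tendsto (fun n : ℕ => 4 * (n : ℝ) / (n.choose 2 : ℕ)) atTop (𝓝 0) := by
  have h : (fun n : ℕ => 8 * ((n : ℝ) - 1)⁻¹) =ᶠ[atTop] fun n : ℕ => 4 * (n : ℝ) / (n.choose 2 : ℕ) := by
    filter_upwards [eventually_ge_atTop 2] with n hn
    have h1 : (2 : ℝ) ≤ n := by exact_mod_cast hn
    have h2 : (n : ℝ) - 1 ≠ 0 := by linarith
    rw [Nat.cast_choose_two]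
    field_simp
    norm_num
  refine Tendsto.congr' h ?_
  have h3 : Tendsto (fun n : ℕ => ((n : ℝ) - 1)) atTop atTop :=
    tendsto_atTop_add_const_right _ _ tendsto_natCast_atTop_atTop
  simpa using h3.inv_tendsto_atTop.const_mul 8

/-- The limit is the factor `2` of `nullCov`: `covEst` is this sequence times an average over pairs.
-/
theorem tendsto_sq_div_choose_two :
    Tendsto (fun n : ℕ => (n : ℝ) ^ 2 * ((n.choose 2 : ℕ) : ℝ)⁻¹) atTop (𝓝 2) := by
  have h : (fun n : ℕ => 2 + 2 * ((n : ℝ) - 1)⁻¹) =ᶠ[atTop]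
      fun n : ℕ => (n : ℝ) ^ 2 * ((n.choose 2 : ℕ) : ℝ)⁻¹ := by
    filter_upwards [eventually_ge_atTop 2] with n hn
    have h1 : (2 : ℝ) ≤ n := by exact_mod_cast hn
    have h2 : (n : ℝ) - 1 ≠ 0 := by linarith
    rw [Nat.cast_choose_two]
    field_simp
    ring
  refine Tendsto.congr' h ?_
  have h3 : Tendsto (fun n : ℕ => ((n : ℝ) - 1)) atTop atTop :=
    tendsto_atTop_add_const_right _ _ tendsto_natCast_atTop_atTop
  simpa using (h3.inv_tendsto_atTop.const_mul 2).const_add 2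

theorem measureReal_le_integral_sq_div {Ω : Type*} [MeasurableSpace Ω] (μ : Measure Ω) {X : Ω → ℝ}
    (hX : Integrable (fun ω => X ω ^ 2) μ) {ε : ℝ} (hε : 0 < ε) :
    μ.real {ω | ε ≤ |X ω|} ≤ (∫ ω, X ω ^ 2 ∂μ) / ε ^ 2 := by
  have h := mul_meas_ge_le_integral_of_nonneg (Eventually.of_forall fun ω => sq_nonneg (X ω)) hX
    (ε ^ 2)
  have hset : {ω | ε ^ 2 ≤ X ω ^ 2} = {ω | ε ≤ |X ω|} := by
    ext ω
    simp only [Set.mem_ofPred_eq]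
    rw [← sq_abs (X ω)]
    exact pow_le_pow_iff_left₀ hε.le (abs_nonneg _) two_ne_zero
  rw [hset] at h
  rw [le_div_iff₀ (by positivity), mul_comm]
  exact h

/-- Events implied by the smallness of finitely many variables with vanishing second moments have
probability tending to one. -/
theorem tendsto_measureReal_one {Ω : ℕ → Type*} [∀ n, MeasurableSpace (Ω n)]
    (μ : ∀ n, Measure (Ω n)) [∀ n, IsProbabilityMeasure (μ n)] {I : Type*} [Fintype I]
    (X : I → ∀ n, Ω n → ℝ) (R : ∀ n, Set (Ω n)) {ε : ℝ} (hε : 0 < ε)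
    (hR : ∀ᶠ n in atTop, ∀ ω, (∀ i, |X i n ω| < ε) → ω ∈ R n)
    (hint : ∀ i, ∀ᶠ n in atTop, Integrable (fun ω => X i n ω ^ 2) (μ n))
    (hX : ∀ i, Tendsto (fun n => ∫ ω, X i n ω ^ 2 ∂μ n) atTop (𝓝 0)) :
    Tendsto (fun n => (μ n).real (R n)) atTop (𝓝 1) := by
  have hlim : Tendsto (fun n => 1 - ∑ i, (∫ ω, X i n ω ^ 2 ∂μ n) / ε ^ 2) atTop (𝓝 1) := by
    have := tendsto_finsetSum Finset.univ fun i _ => (hX i).div_const (ε ^ 2)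
    simpa using this.const_sub 1
  refine tendsto_of_tendsto_of_tendsto_of_le_of_le' hlim tendsto_const_nhds ?_
    (Eventually.of_forall fun n => measureReal_le_one)
  filter_upwards [hR, eventually_all.mpr hint] with n hn hi
  -- A union bound followed by Chebyshev's inequality; subadditivity does not require `R n` to be
  -- measurable.
  have hcov : Set.univ ⊆ R n ∪ ⋃ i, {ω | ε ≤ |X i n ω|} := by
    intro ω _
    by_cases h : ∀ i, |X i n ω| < ε
    · exact Or.inl (hn ω h)
    · push Not at h
      exact Or.inr (Set.mem_iUnion.mpr h)
  have h1 : (1 : ℝ) ≤ (μ n).real (R n) + ∑ i, (μ n).real {ω | ε ≤ |X i n ω|} := by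
    calc (1 : ℝ) = (μ n).real Set.univ := by simp
      _ ≤ _ := measureReal_mono hcov
      _ ≤ _ := measureReal_union_le _ _
      _ ≤ _ := by
        gcongr
        exact measureReal_iUnion_fintype_le _
  have h2 := Finset.sum_le_sum fun i (_ : i ∈ Finset.univ) =>
    measureReal_le_integral_sq_div (μ n) (hi i) hε
  linarith

/-! ### Independence in product spaces -/

section PiMeasure

variable {𝒲 : Type*} [MeasurableSpace 𝒲]

/-- Distinct coordinates of an i.i.d. family are again i.i.d. This is where the absence of
collisions enters the analysis of resampling. -/
theorem measurePreserving_comp_injective {ι κ : Type*} [Fintype ι] [Fintype κ] (W : Measure 𝒲)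
    [IsProbabilityMeasure W] {k : κ → ι} (hk : k.Injective) :
    MeasurePreserving (fun (d : ι → 𝒲) t => d (k t)) (Measure.pi fun _ => W)
      (Measure.pi fun _ => W) := by
  refine ⟨by fun_prop, ?_⟩
  have h1 : iIndepFun (fun i (d : ι → 𝒲) => d i) (Measure.pi fun _ => W) :=
    iIndepFun_pi (X := fun _ => id) fun _ => aemeasurable_id
  have h2 := (iIndepFun_iff_map_fun_eq_pi_map
    fun t => (measurable_pi_apply (k t)).aemeasurable).mp (h1.precomp hk)
  rw [h2]
  congr 1
  ext1 t
  exact (measurePreserving_eval (fun _ : ι => W) (k t)).map_eq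

theorem measurePreserving_uncurry {ι κ : Type*} [Fintype ι] [Fintype κ] (W : Measure 𝒲)
    [SigmaFinite W] : MeasurePreserving (MeasurableEquiv.curry ι κ 𝒲).symm
      (Measure.pi fun _ => Measure.pi fun _ => W) (Measure.pi fun _ => W) := by
  refine ⟨MeasurableEquiv.measurable _, (Measure.pi_eq fun s hs => ?_).symm⟩
  rw [MeasurableEquiv.map_apply]
  have h : (MeasurableEquiv.curry ι κ 𝒲).symm ⁻¹' (Set.univ.pi s) =
      Set.univ.pi fun i => Set.univ.pi fun j => s (i, j) := by
    ext u
    simp [Set.mem_pi, MeasurableEquiv.coe_curry_symm]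
  rw [h, Measure.pi_pi, Fintype.prod_prod_type]
  simp [Measure.pi_pi]

theorem measurePreserving_pair {ι : Type*} [Fintype ι] (W : Measure 𝒲) [IsProbabilityMeasure W]
    {i j : ι} (hij : i ≠ j) :
    MeasurePreserving (fun d : ι → 𝒲 => (d i, d j)) (Measure.pi fun _ => W) (W.prod W) := by
  have h1 := measurePreserving_comp_injective (κ := Fin 2) W (k := ![i, j]) (by
    intro a b
    fin_cases a <;> fin_cases b <;> simp [hij, hij.symm])
  exact (measurePreserving_finTwoArrow W).comp h1

/-- Functions of disjoint pairs of independent variables are uncorrelated. -/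
theorem integral_pi_mul_eq_zero {ι : Type*} [Fintype ι] (W : Measure 𝒲) [IsProbabilityMeasure W]
    {f : 𝒲 × 𝒲 → ℝ} (hf : Measurable f) (h0 : ∫ p, f p ∂(W.prod W) = 0) {i j k l : ι}
    (hij : i ≠ j) (hik : i ≠ k) (hil : i ≠ l) (hjk : j ≠ k) (hjl : j ≠ l) :
    ∫ d : ι → 𝒲, f (d i, d j) * f (d k, d l) ∂(Measure.pi fun _ => W) = 0 := by
  have h1 : iIndepFun (fun i (d : ι → 𝒲) => d i) (Measure.pi fun _ => W) :=
    iIndepFun_pi (X := fun _ => id) fun _ => aemeasurable_id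
  have h2 := (h1.indepFun_prodMk_prodMk (fun i => by fun_prop) i j k l hik hil hjk hjl).comp hf hf
  have h3 := h2.integral_fun_mul_eq_mul_integral
    (hf.comp (by fun_prop)).aestronglyMeasurable (hf.comp (by fun_prop)).aestronglyMeasurable
  simp only [Function.comp_apply] at h3
  have h4 := measurePreserving_pair W hij
  rw [← h4.map_eq, integral_map h4.aemeasurable hf.aestronglyMeasurable] at h0
  rw [h3, h0, zero_mul]

end PiMeasure

/-! ### Sampling with replacement is nearly independent sampling -/

section Resampling

variable {𝒲 S T : Type*} [MeasurableSpace 𝒲] [Fintype S] [Fintype T]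

theorem uniformOn_univ_prod (α β : Type*) [Fintype α] [Fintype β] [MeasurableSpace α]
    [MeasurableSpace β] [MeasurableSingletonClass α] [MeasurableSingletonClass β] :
    (uniformOn Set.univ : Measure (α × β)) = (uniformOn Set.univ).prod (uniformOn Set.univ) := by
  refine Measure.ext_of_singleton fun p => ?_
  rw [← Set.singleton_prod_singleton, Measure.prod_prod]
  simp only [uniformOn_univ, Set.singleton_prod_singleton, Measure.count_singleton,
    Fintype.card_prod, Nat.cast_mul, one_div]
  exact ENNReal.mul_inv (by simp) (by simp)

/-- Birthday bound. A collision means the same observation `(r t).1`, whichever entry is read, since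
the two entries of one observation may be dependent; each pair of slots collides with probability `1
/ n`. -/
theorem measureReal_collision_le {n : ℕ} (hn : 0 < n) :
    (Measure.pi fun _ : T => (uniformOn Set.univ : Measure (Fin n × Fin 2))).real
      {r | ¬ Function.Injective fun t => (r t).1} ≤ (Fintype.card T : ℝ) ^ 2 / n := by
  classical
  have : NeZero n := ⟨hn.ne'⟩
  set ν := Measure.pi fun _ : T => (uniformOn Set.univ : Measure (Fin n × Fin 2)) with hν
  have hfst : MeasurePreserving (Prod.fst : Fin n × Fin 2 → Fin n) (uniformOn Set.univ)
      (uniformOn Set.univ) := by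
    rw [uniformOn_univ_prod]
    exact measurePreserving_fst
  have hpair : ∀ t t' : T, t ≠ t' → ν.real {r | (r t).1 = (r t').1} = 1 / n := by
    intro t t' htt
    have h1 : MeasurePreserving (fun r : T → Fin n × Fin 2 => ((r t).1, (r t').1)) ν
        ((uniformOn Set.univ).prod (uniformOn Set.univ)) :=
      (hfst.prod hfst).comp (measurePreserving_pair (uniformOn Set.univ) htt)
    have h2 := measureReal_prod_fintype (uniformOn Set.univ : Measure (Fin n))
      (uniformOn Set.univ : Measure (Fin n)) (A := fun e => {e})
      fun e => MeasurableSet.singleton e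
    have h3 : ν.real {r | (r t).1 = (r t').1} =
        ((uniformOn Set.univ : Measure (Fin n)).prod (uniformOn Set.univ)).real
          {p | p.1 ∈ ({p.2} : Set (Fin n))} := by
      rw [measureReal_def, measureReal_def,
        ← h1.measure_preimage (MeasurableSet.of_discrete).nullMeasurableSet]
      rfl
    rw [h3, h2]
    have hn' : (n : ℝ) ≠ 0 := by exact_mod_cast hn.ne'
    simp [measureReal_def, uniformOn_univ]
    field_simp
  have hcov : {r : T → Fin n × Fin 2 | ¬ Function.Injective fun t => (r t).1} ⊆
      ⋃ p ∈ (Finset.univ.filter fun p : T × T => p.1 ≠ p.2), {r | (r p.1).1 = (r p.2).1} := by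
    intro r hr
    simp only [Set.mem_ofPred_eq, Function.Injective, not_forall] at hr
    obtain ⟨t, t', h, htt⟩ := hr
    simp only [Set.mem_iUnion]
    exact ⟨(t, t'), by simpa using htt, h⟩
  calc _ ≤ _ := measureReal_mono hcov (measure_ne_top _ _)
    _ ≤ ∑ p ∈ (Finset.univ.filter fun p : T × T => p.1 ≠ p.2), ν.real {r | (r p.1).1 = (r p.2).1} :=
        measureReal_biUnion_finset_le _ _
    _ = ∑ _p ∈ (Finset.univ.filter fun p : T × T => p.1 ≠ p.2), (1 / n : ℝ) :=
        Finset.sum_congr rfl fun p hp => hpair _ _ (Finset.mem_filter.mp hp).2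
    _ ≤ ∑ _p : T × T, (1 / n : ℝ) :=
        Finset.sum_le_sum_of_subset_of_nonneg (Finset.filter_subset _ _) fun _ _ _ => by positivity
    _ = _ := by
        simp [Fintype.card_prod]
        ring

theorem abs_integral_le_of_bound {Ω : Type*} [MeasurableSpace Ω] (μ : Measure Ω)
    [IsProbabilityMeasure μ] {f : Ω → ℝ} {C : ℝ} (hf : ∀ ω, |f ω| ≤ C) : |∫ ω, f ω ∂μ| ≤ C := by
  simpa using norm_integral_le_of_norm_le_const (μ := μ) (f := f) (C := C)
    (Eventually.of_forall fun ω => by simpa using hf ω)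

omit [Fintype T] in
theorem measurable_draws {n : ℕ} : Measurable fun (ω : (Fin n → 𝒲) × (T → Fin n × Fin 2)) t =>
    (ω.1 (ω.2 t).1, (ω.2 t).2) := by
  refine measurable_pi_lambda _ fun t => ?_
  have h : Measurable fun ω : (Fin n → 𝒲) × (T → Fin n × Fin 2) => (ω.1, ω.2 t) := by fun_prop
  exact measurable_draw.comp h

/-- Filling slots by drawing with replacement from `n` independent observations is close, uniformly
over bounded statistics, to filling them with independent observations. -/
theorem abs_integral_draws_sub_le (W : Measure 𝒲) [IsProbabilityMeasure W] {n : ℕ} (hn : 0 < n)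
    {Ψ : (T → 𝒲 × Fin 2) → ℝ} (hΨ : Measurable Ψ) {C : ℝ} (hC : ∀ u, |Ψ u| ≤ C) :
    |∫ ω, Ψ (fun t => (ω.1 (ω.2 t).1, (ω.2 t).2))
        ∂((Measure.pi fun _ : Fin n => W).prod
          (Measure.pi fun _ : T => (uniformOn Set.univ : Measure (Fin n × Fin 2)))) -
      ∫ u, Ψ u ∂(Measure.pi fun _ => W.prod (uniformOn Set.univ))| ≤
      2 * C * ((Fintype.card T : ℝ) ^ 2 / n) := by
  have : NeZero n := ⟨hn.ne'⟩
  set ν := Measure.pi fun _ : T => (uniformOn Set.univ : Measure (Fin n × Fin 2)) with hν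
  -- Conditionally on the indices `r`, `A` is the mean for the actual draws and `G` the mean for
  -- fresh observations with the same entry labels. They agree when no observation is drawn twice,
  -- and otherwise differ by at most `2 * C`.
  let A : (T → Fin n × Fin 2) → ℝ := fun r =>
    ∫ d : Fin n → 𝒲, Ψ (fun t => (d (r t).1, (r t).2)) ∂(Measure.pi fun _ => W)
  let G : (T → Fin 2) → ℝ := fun s => ∫ D : T → 𝒲, Ψ (fun t => (D t, s t)) ∂(Measure.pi fun _ => W)
  have hA : ∀ r, |A r| ≤ C := fun r => abs_integral_le_of_bound _ fun d => hC _
  have hG : ∀ s, |G s| ≤ C := fun s => abs_integral_le_of_bound _ fun d => hC _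
  have h1 : ∫ ω, Ψ (fun t => (ω.1 (ω.2 t).1, (ω.2 t).2))
      ∂((Measure.pi fun _ : Fin n => W).prod ν) = ∫ r, A r ∂ν := by
    refine integral_prod_symm _ (Integrable.of_bound ?_ C (Eventually.of_forall fun ω => hC _))
    exact (hΨ.comp measurable_draws).aestronglyMeasurable
  have h2 : ∫ u, Ψ u ∂(Measure.pi fun _ : T => W.prod (uniformOn Set.univ : Measure (Fin 2))) =
      ∫ r, G (fun t => (r t).2) ∂ν := by
    have hsnd : MeasurePreserving (Prod.snd : Fin n × Fin 2 → Fin 2) (uniformOn Set.univ)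
        (uniformOn Set.univ) := by
      rw [uniformOn_univ_prod]
      exact measurePreserving_snd
    have h3 : MeasurePreserving (fun (r : T → Fin n × Fin 2) t => (r t).2) ν
        (Measure.pi fun _ => uniformOn Set.univ) := measurePreserving_pi _ _ fun _ => hsnd
    have h4 : ∫ r, G (fun t => (r t).2) ∂ν =
        ∫ s, G s ∂(Measure.pi fun _ : T => (uniformOn Set.univ : Measure (Fin 2))) := by
      rw [← h3.map_eq, integral_map h3.aemeasurable]
      exact (measurable_of_finite G).aestronglyMeasurable
    have h5 := measurePreserving_arrowProdEquivProdArrow 𝒲 (Fin 2) T (fun _ => W)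
      (fun _ => (uniformOn Set.univ : Measure (Fin 2)))
    rw [h4, ← h5.symm.integral_comp']
    refine integral_prod_symm _ (Integrable.of_bound ?_ C (Eventually.of_forall fun ω => hC _))
    exact (hΨ.comp (MeasurableEquiv.measurable _)).aestronglyMeasurable
  have hAG : ∀ r, |A r - G (fun t => (r t).2)| ≤
      {r : T → Fin n × Fin 2 | ¬ Function.Injective fun t => (r t).1}.indicator
        (fun _ => 2 * C) r := by
    intro r
    by_cases hr : Function.Injective fun t => (r t).1
    · have h3 := measurePreserving_comp_injective W hr
      have h4 : G (fun t => (r t).2) = A r := by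
        simp only [G, A]
        rw [← h3.map_eq, integral_map h3.aemeasurable]
        exact (hΨ.comp (by fun_prop)).aestronglyMeasurable
      simp [h4, hr]
    · rw [Set.indicator_of_mem (by exact hr)]
      refine (abs_sub _ _).trans ?_
      linarith [hA r, hG fun t => (r t).2]
  have hintA : Integrable A ν := Integrable.of_finite
  have hintG : Integrable (fun r => G (fun t => (r t).2)) ν := Integrable.of_finite
  rw [h1, h2, ← integral_sub hintA hintG]
  have hC0 : 0 ≤ C := (abs_nonneg _).trans (hG fun _ => 0)
  calc _ ≤ ∫ r, |A r - G (fun t => (r t).2)| ∂ν := abs_integral_le_integral_abs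
    _ ≤ ∫ r, {r : T → Fin n × Fin 2 | ¬ Function.Injective fun t => (r t).1}.indicator
        (fun _ => 2 * C) r ∂ν := integral_mono Integrable.of_finite Integrable.of_finite hAG
    _ = 2 * C * ν.real {r | ¬ Function.Injective fun t => (r t).1} := by
        rw [integral_indicator_const _ MeasurableSet.of_discrete, smul_eq_mul, mul_comm]
    _ ≤ _ := by
        gcongr
        exact measureReal_collision_le hn

/-- The law of the simulated null observations, if all slots are filled with independent
observations. -/
def slotNullLaw (W : Measure 𝒲) (Φ : (S → 𝒲 × Fin 2) → 𝒲) : Measure 𝒲 :=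
  (Measure.pi fun _ => W.prod (uniformOn Set.univ)).map Φ

/-- Distinct null observations use disjoint families of slots, so together they amount to `T × S`
independent draws from the pool. -/
theorem abs_integral_nullSample_sub_le (W : Measure 𝒲) [IsProbabilityMeasure W]
    {Φ : (S → 𝒲 × Fin 2) → 𝒲} (hΦ : Measurable Φ) {n : ℕ} (hn : 0 < n) {ι : T → Fin n}
    (hι : ι.Injective) {H : (T → 𝒲) → ℝ} (hH : Measurable H) {C : ℝ} (hC : ∀ u, |H u| ≤ C) :
    |∫ ω, H (fun t => nullSample Φ ω.1 ω.2 (ι t))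
        ∂((Measure.pi fun _ : Fin n => W).prod (slotLaw S n)) -
      ∫ u, H u ∂(Measure.pi fun _ => slotNullLaw W Φ)| ≤
      2 * C * ((Fintype.card (T × S) : ℝ) ^ 2 / n) := by
  have : NeZero n := ⟨hn.ne'⟩
  have hprob : IsProbabilityMeasure (slotNullLaw W Φ) :=
    Measure.isProbabilityMeasure_map hΦ.aemeasurable
  let Ψ : (T × S → 𝒲 × Fin 2) → ℝ := fun u => H fun t => Φ fun s => u (t, s)
  have hΨ : Measurable Ψ := hH.comp (measurable_pi_lambda _ fun t => hΦ.comp (by fun_prop))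
  have h1 : MeasurePreserving (fun (J : Fin n → S → Fin n × Fin 2) (p : T × S) => J (ι p.1) p.2)
      (slotLaw S n) (Measure.pi fun _ => uniformOn Set.univ) :=
    (measurePreserving_uncurry (ι := T) (κ := S)
      (uniformOn Set.univ : Measure (Fin n × Fin 2))).comp
      (measurePreserving_comp_injective
        (Measure.pi fun _ : S => (uniformOn Set.univ : Measure (Fin n × Fin 2))) hι)
  have h2 := (MeasurePreserving.id (Measure.pi fun _ : Fin n => W)).prod h1
  have h3 : MeasurePreserving (fun (u : T × S → 𝒲 × Fin 2) t => Φ fun s => u (t, s))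
      (Measure.pi fun _ => W.prod (uniformOn Set.univ)) (Measure.pi fun _ => slotNullLaw W Φ) :=
    (measurePreserving_pi _ _ fun _ : T => (⟨hΦ, rfl⟩ : MeasurePreserving Φ
      (Measure.pi fun _ => W.prod (uniformOn Set.univ)) (slotNullLaw W Φ))).comp
      (measurePreserving_uncurry (ι := T) (κ := S) (W.prod (uniformOn Set.univ))).symm
  have h4 := abs_integral_draws_sub_le W hn hΨ (C := C) fun u => hC _
  rw [← h2.map_eq, integral_map h2.aemeasurable] at h4
  · rw [← h3.map_eq, integral_map h3.aemeasurable hH.aestronglyMeasurable]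
    exact h4
  · exact (hΨ.comp measurable_draws).aestronglyMeasurable

end Resampling

/-! ### Power -/

section Power

theorem tendsto_integral_avgPairs_sq {Ω : ℕ → Type*} [∀ n, MeasurableSpace (Ω n)]
    (μ : ∀ n, Measure (Ω n)) [∀ n, IsProbabilityMeasure (μ n)]
    {X : ∀ n, Ω n → Fin n → Fin n → ℝ} {C K : ℝ} (hK : 0 ≤ K)
    (hX : ∀ n i j, Measurable fun ω => X n ω i j) (hC : ∀ n ω i j, |X n ω i j| ≤ C)
    (hdisj : ∀ n i j k l, i ≠ j → k ≠ l → i ≠ k → i ≠ l → j ≠ k → j ≠ l →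
      |∫ ω, X n ω i j * X n ω k l ∂μ n| ≤ K / n) :
    (∀ᶠ n in atTop, Integrable (fun ω => avgPairs n (X n ω) ^ 2) (μ n)) ∧
      Tendsto (fun n => ∫ ω, avgPairs n (X n ω) ^ 2 ∂μ n) atTop (𝓝 0) := by
  have h : ∀ n, 2 ≤ n → _ := fun n hn => integral_avgPairs_sq_le (μ n) hn (η := K / n)
    (by positivity) (hX n) (hC n) (hdisj n)
  refine ⟨(eventually_ge_atTop 2).mono fun n hn => (h n hn).1, ?_⟩
  have hlim : Tendsto (fun n : ℕ => K / n + C ^ 2 * (4 * n / (n.choose 2 : ℕ))) atTop (𝓝 0) := by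
    have h1 : Tendsto (fun n : ℕ => K / (n : ℝ)) atTop (𝓝 0) :=
      tendsto_const_nhds.div_atTop tendsto_natCast_atTop_atTop
    simpa using h1.add (tendsto_div_choose_two.const_mul (C ^ 2))
  refine squeeze_zero' (Eventually.of_forall fun n => integral_nonneg fun ω => sq_nonneg _) ?_ hlim
  exact (eventually_ge_atTop 2).mono fun n hn => (h n hn).2

theorem abs_units_cast (u : ℤˣ) : |((u : ℤ) : ℝ)| = 1 := by
  rcases Int.units_eq_one_or u with rfl | rfl <;> simp

/-- Negating the sign at `i` permutes the equally likely sign patterns and negates the product,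
because `i` differs from `j`, `k` and `l`. -/
theorem integral_signs_eq_zero {B n : ℕ} (b : Fin B) {i j k l : Fin n} (hij : i ≠ j) (hik : i ≠ k)
    (hil : i ≠ l) : ∫ ε : Fin B → Fin n → ℤˣ, (((ε b i : ℤ) : ℝ) * ((ε b j : ℤ) : ℝ)) *
      (((ε b k : ℤ) : ℝ) * ((ε b l : ℤ) : ℝ)) ∂(signLaw B n) = 0 := by
  let e : (Fin B → Fin n → ℤˣ) ≃ (Fin B → Fin n → ℤˣ) :=
    Equiv.mulLeft fun _ m => if m = i then -1 else 1
  rw [integral_fintype Integrable.of_finite]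
  simp only [signLaw_singleton, smul_eq_mul, ← Finset.mul_sum]
  refine mul_eq_zero_of_right _ ?_
  have h := Equiv.sum_comp e fun ε : Fin B → Fin n → ℤˣ =>
    (((ε b i : ℤ) : ℝ) * ((ε b j : ℤ) : ℝ)) * (((ε b k : ℤ) : ℝ) * ((ε b l : ℤ) : ℝ))
  simp [e, hij.symm, hik.symm, hil.symm] at h
  linarith

variable {𝒲 S : Type*} [MeasurableSpace 𝒲] [Fintype S]

theorem abs_sub_integral_le {f : 𝒲 × 𝒲 → ℝ} {C : ℝ} (hC : ∀ p, |f p| ≤ C)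
    (W : Measure 𝒲) [IsProbabilityMeasure W] (p : 𝒲 × 𝒲) :
    |f p - ∫ q, f q ∂(W.prod W)| ≤ 2 * C := by
  refine (abs_sub _ _).trans ?_
  linarith [hC p, abs_integral_le_of_bound (W.prod W) hC]

theorem integral_sub_integral_eq_zero {f : 𝒲 × 𝒲 → ℝ} (hf : Measurable f) {C : ℝ}
    (hC : ∀ p, |f p| ≤ C) (W : Measure 𝒲) [IsProbabilityMeasure W] :
    ∫ p, (f p - ∫ q, f q ∂(W.prod W)) ∂(W.prod W) = 0 := by
  rw [integral_sub (Integrable.of_bound hf.aestronglyMeasurable C (Eventually.of_forall hC))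
    (integrable_const _)]
  simp

/-- The joint law of the observations, the resampling indices and the signs. -/
def poolLaw (S : Type*) [Fintype S] (B : ℕ) (W : Measure 𝒲) (n : ℕ) :
    Measure (((Fin n → 𝒲) × (Fin n → S → Fin n × Fin 2)) × (Fin B → Fin n → ℤˣ)) :=
  ((Measure.pi fun _ : Fin n => W).prod (slotLaw S n)).prod (signLaw B n)

instance (B : ℕ) (W : Measure 𝒲) [IsProbabilityMeasure W] (n : ℕ) :
    IsProbabilityMeasure (poolLaw S B W n) := by
  unfold poolLaw; infer_instance

variable (S) in
theorem tendsto_integral_avgPairs_sample (B : ℕ) (W : Measure 𝒲) [IsProbabilityMeasure W]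
    {f : 𝒲 × 𝒲 → ℝ} (hf : Measurable f) {C : ℝ} (hC : ∀ p, |f p| ≤ C) :
    (∀ᶠ n in atTop, Integrable (fun ω => avgPairs n
      (fun i j => f (ω.1.1 i, ω.1.1 j) - ∫ q, f q ∂(W.prod W)) ^ 2) (poolLaw S B W n)) ∧
    Tendsto (fun n => ∫ ω, avgPairs n
      (fun i j => f (ω.1.1 i, ω.1.1 j) - ∫ q, f q ∂(W.prod W)) ^ 2 ∂(poolLaw S B W n))
      atTop (𝓝 0) := by
  refine tendsto_integral_avgPairs_sq (fun n => poolLaw S B W n)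
    (X := fun n ω i j => f (ω.1.1 i, ω.1.1 j) - ∫ q, f q ∂(W.prod W)) (C := 2 * C) le_rfl
    (fun n i j => (hf.comp (by fun_prop)).sub_const _)
    (fun n ω i j => abs_sub_integral_le hC W _)
    fun n i j k l hij _ hik hil hjk hjl => ?_
  have h1 : MeasurePreserving (fun ω : ((Fin n → 𝒲) × (Fin n → S → Fin n × Fin 2)) ×
      (Fin B → Fin n → ℤˣ) => ω.1.1) (poolLaw S B W n) (Measure.pi fun _ => W) :=
    measurePreserving_fst.comp measurePreserving_fst
  have h2 := integral_pi_mul_eq_zero (ι := Fin n) W (hf.sub_const (∫ q, f q ∂(W.prod W)))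
    (integral_sub_integral_eq_zero hf hC W) hij hik hil hjk hjl
  rw [← h1.map_eq, integral_map h1.aemeasurable] at h2
  · rw [h2]
    simp
  · exact (((hf.comp (by fun_prop)).sub_const _).mul
      ((hf.comp (by fun_prop)).sub_const _)).aestronglyMeasurable

variable (S) in
-- No centring is needed: the signs alone make terms without common indices uncorrelated, whatever
-- the mean of `f`. Hence the bootstrap statistics vanish under alternatives as well.
theorem tendsto_integral_avgPairs_signs {B : ℕ} (b : Fin B) (W : Measure 𝒲)
    [IsProbabilityMeasure W] {f : 𝒲 × 𝒲 → ℝ} (hf : Measurable f) {C : ℝ} (hC : ∀ p, |f p| ≤ C) :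
    (∀ᶠ n in atTop, Integrable (fun ω => avgPairs n (fun i j => ((ω.2 b i : ℤ) : ℝ) *
      ((ω.2 b j : ℤ) : ℝ) * f (ω.1.1 i, ω.1.1 j)) ^ 2) (poolLaw S B W n)) ∧
    Tendsto (fun n => ∫ ω, avgPairs n (fun i j => ((ω.2 b i : ℤ) : ℝ) *
      ((ω.2 b j : ℤ) : ℝ) * f (ω.1.1 i, ω.1.1 j)) ^ 2 ∂(poolLaw S B W n)) atTop (𝓝 0) := by
  refine tendsto_integral_avgPairs_sq (fun n => poolLaw S B W n) (X := fun n ω i j =>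
    ((ω.2 b i : ℤ) : ℝ) * ((ω.2 b j : ℤ) : ℝ) * f (ω.1.1 i, ω.1.1 j)) (C := C) le_rfl
    (fun n i j => Measurable.mul ?_ (hf.comp (by fun_prop)))
    (fun n ω i j => by simpa [abs_mul, abs_units_cast] using hC _)
    fun n i j k l hij _ hik hil hjk hjl => ?_
  · exact (measurable_of_finite fun ε : Fin B → Fin n → ℤˣ =>
      ((ε b i : ℤ) : ℝ) * ((ε b j : ℤ) : ℝ)).comp measurable_snd
  · have h1 := integral_prod_mul (μ := (Measure.pi fun _ : Fin n => W).prod (slotLaw S n))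
      (ν := signLaw B n)
      (fun z => f (z.1 i, z.1 j) * f (z.1 k, z.1 l)) (fun ε => (((ε b i : ℤ) : ℝ) *
        ((ε b j : ℤ) : ℝ)) * (((ε b k : ℤ) : ℝ) * ((ε b l : ℤ) : ℝ)))
    rw [integral_signs_eq_zero b hij hik hil, mul_zero] at h1
    rw [zero_div, abs_nonpos_iff, ← h1]
    refine integral_congr_ae (Eventually.of_forall fun ω => ?_)
    simp only
    ring

theorem tendsto_integral_avgPairs_nullSample (B : ℕ) (W : Measure 𝒲) [IsProbabilityMeasure W]
    {Φ : (S → 𝒲 × Fin 2) → 𝒲} (hΦ : Measurable Φ)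
    {f : 𝒲 × 𝒲 → ℝ} (hf : Measurable f) {C : ℝ} (hC : ∀ p, |f p| ≤ C) :
    (∀ᶠ n in atTop, Integrable (fun ω => avgPairs n (fun i j =>
      f (nullSample Φ ω.1.1 ω.1.2 i, nullSample Φ ω.1.1 ω.1.2 j) -
        ∫ q, f q ∂((slotNullLaw W Φ).prod (slotNullLaw W Φ))) ^ 2) (poolLaw S B W n)) ∧
    Tendsto (fun n => ∫ ω, avgPairs n (fun i j =>
      f (nullSample Φ ω.1.1 ω.1.2 i, nullSample Φ ω.1.1 ω.1.2 j) -
        ∫ q, f q ∂((slotNullLaw W Φ).prod (slotNullLaw W Φ))) ^ 2 ∂(poolLaw S B W n))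
      atTop (𝓝 0) := by
  have hprob : IsProbabilityMeasure (slotNullLaw W Φ) :=
    Measure.isProbabilityMeasure_map hΦ.aemeasurable
  let g : 𝒲 × 𝒲 → ℝ := fun p => f p - ∫ q, f q ∂((slotNullLaw W Φ).prod (slotNullLaw W Φ))
  have hg : Measurable g := hf.sub_const _
  have hgC : ∀ p, |g p| ≤ 2 * C := abs_sub_integral_le hC _
  have hmeas : ∀ n (i j : Fin n), Measurable fun z : (Fin n → 𝒲) × (Fin n → S → Fin n × Fin 2) =>
      g (nullSample Φ z.1 z.2 i, nullSample Φ z.1 z.2 j) := fun n i j =>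
    hg.comp ((measurable_nullSample hΦ i).prodMk (measurable_nullSample hΦ j))
  refine tendsto_integral_avgPairs_sq (fun n => poolLaw S B W n)
    (X := fun n ω i j => g (nullSample Φ ω.1.1 ω.1.2 i, nullSample Φ ω.1.1 ω.1.2 j)) (C := 2 * C)
    (K := 2 * (2 * C) ^ 2 * (Fintype.card (Fin 4 × S) : ℝ) ^ 2) (by positivity)
    (fun n i j => (hmeas n i j).comp measurable_fst) (fun n ω i j => hgC _)
    fun n i j k l hij hkl hik hil hjk hjl => ?_
  have hn : 0 < n := i.pos
  have hι : Function.Injective ![i, j, k, l] := by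
    intro a b
    fin_cases a <;> fin_cases b <;> simp [*, Ne.symm]
  -- Four null observations use `4 |S|` slots. With independent slots the centred product has mean
  -- zero, so only the collision error of order `1 / n` remains.
  have h1 := abs_integral_nullSample_sub_le W hΦ hn hι
    (H := fun u => g (u 0, u 1) * g (u 2, u 3)) (by fun_prop) (C := (2 * C) ^ 2) fun u => by
      rw [abs_mul, sq]
      exact mul_le_mul (hgC _) (hgC _) (abs_nonneg _) ((abs_nonneg _).trans (hgC (u 0, u 1)))
  rw [integral_pi_mul_eq_zero (slotNullLaw W Φ) hg (integral_sub_integral_eq_zero hf hC _)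
    (by decide) (by decide) (by decide) (by decide) (by decide), sub_zero] at h1
  have h2 : MeasurePreserving Prod.fst (poolLaw S B W n)
    ((Measure.pi fun _ : Fin n => W).prod (slotLaw S n)) := measurePreserving_fst
  rw [← h2.map_eq, integral_map h2.aemeasurable] at h1
  · refine h1.trans_eq ?_
    ring
  · exact ((hmeas n i j).mul (hmeas n k l)).aestronglyMeasurable

/-- Consistency of the test. -/
theorem tendsto_poolRejectProb {c B : ℕ} {α : ℝ} (hα₀ : 0 < α) (hα₁ : α < 1)
    (hB : 1 ≤ α * ((B : ℝ) + 1)) {Ftr : Fin c → ℤˣ}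
    {h : Fin c → 𝒲 → 𝒲 → ℝ} (hh : ∀ a, Measurable fun p : 𝒲 × 𝒲 => h a p.1 p.2)
    {C : ℝ} (hC : ∀ a w w', |h a w w'| ≤ C) {W : Measure 𝒲} [IsProbabilityMeasure W]
    {Φ : (S → 𝒲 × Fin 2) → 𝒲} (hΦ : Measurable Φ)
    (hS : (nullCov h (slotNullLaw W Φ)).PosDef)
    (hsgn : SignAgreement Ftr (nullCov h (slotNullLaw W Φ)) (popU h W)) :
    Tendsto (fun n => poolRejectProb B α Ftr h W Φ n) atTop (𝓝 1) := by
  obtain ⟨ε, hε, H⟩ := exists_forall_selStat_lt hS hsgn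
  let f : Fin c → 𝒲 × 𝒲 → ℝ := fun a p => h a p.1 p.2
  let ff : Fin c × Fin c → 𝒲 × 𝒲 → ℝ := fun r p => h r.1 p.1 p.2 * h r.2 p.1 p.2
  have hf : ∀ a p, |f a p| ≤ C := fun a p => hC _ _ _
  have hff : ∀ r p, |ff r p| ≤ C ^ 2 := fun r p => by
    rw [abs_mul, sq]
    exact mul_le_mul (hC _ _ _) (hC _ _ _) (abs_nonneg _) ((abs_nonneg _).trans (hf r.1 p))
  have hffm : ∀ r, Measurable (ff r) := fun r => (hh r.1).mul (hh r.2)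
  let m : Fin c × Fin c → ℝ := fun r =>
    ∫ q, ff r q ∂((slotNullLaw W Φ).prod (slotNullLaw W Φ))
  -- The three sources of error: the `U`-statistic, the covariance entries before the normalising
  -- factor, and the bootstrap statistics.
  let X : Fin c ⊕ (Fin c × Fin c) ⊕ (Fin B × Fin c) → ∀ n,
      ((Fin n → 𝒲) × (Fin n → S → Fin n × Fin 2)) × (Fin B → Fin n → ℤˣ) → ℝ :=
    Sum.elim
      (fun a n ω => avgPairs n fun i j => f a (ω.1.1 i, ω.1.1 j) - ∫ q, f a q ∂(W.prod W))
      (Sum.elim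
        (fun r n ω => avgPairs n fun i j =>
          ff r (nullSample Φ ω.1.1 ω.1.2 i, nullSample Φ ω.1.1 ω.1.2 j) - m r)
        (fun r n ω => avgPairs n fun i j => ((ω.2 r.1 i : ℤ) : ℝ) * ((ω.2 r.1 j : ℤ) : ℝ) *
          f r.2 (ω.1.1 i, ω.1.1 j)))
  have hX : ∀ t, (∀ᶠ n in atTop, Integrable (fun ω => X t n ω ^ 2) (poolLaw S B W n)) ∧
      Tendsto (fun n => ∫ ω, X t n ω ^ 2 ∂(poolLaw S B W n)) atTop (𝓝 0) := by
    rintro (a | r | r)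
    · exact tendsto_integral_avgPairs_sample S B W (hh a) (hf a)
    · exact tendsto_integral_avgPairs_nullSample B W hΦ (hffm r) (hff r)
    · exact tendsto_integral_avgPairs_signs S r.1 W (hh r.2) (hf r.2)
  refine tendsto_measureReal_one (fun n => poolLaw S B W n) X
    (fun n => {ω | Rejects α Ftr h ω.1.1 (nullSample Φ ω.1.1 ω.1.2) ω.2}) (ε := ε / 8)
    (by positivity) ?_ (fun t => (hX t).1) (fun t => (hX t).2)
  -- The factor of `covEst` tends to `2` and is eventually below `4`, so a random error of `ε / 8`
  -- grows to at most `ε / 2`; the other `ε / 2` is for the deterministic error of the factor.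
  have hc1 : ∀ᶠ n : ℕ in atTop, (n : ℝ) ^ 2 * ((n.choose 2 : ℕ) : ℝ)⁻¹ < 4 :=
    tendsto_sq_div_choose_two.eventually_lt_const (by norm_num)
  have hc2 : ∀ᶠ n : ℕ in atTop, ∀ r : Fin c × Fin c,
      |((n : ℝ) ^ 2 * ((n.choose 2 : ℕ) : ℝ)⁻¹ - 2) * m r| < ε / 2 := by
    refine eventually_all.mpr fun r => ?_
    have h1 := ((tendsto_sq_div_choose_two.sub_const 2).mul_const (m r)).abs
    simp only [sub_self, zero_mul, abs_zero] at h1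
    exact h1.eventually_lt_const (by positivity)
  filter_upwards [hc1, hc2, eventually_ge_atTop 2] with n hn1 hn2 hn ω hω
  refine threshold_lt_of_forall_lt hα₀ hα₁ hB fun b => ?_
  refine H _ (posSemidef_covEst _ _) (fun a a' => ?_) _ (fun a => ?_) _ (fun a => ?_) n (by omega)
  · have h1 := hω (Sum.inr (Sum.inl (a, a')))
    simp only [X, Sum.elim_inr, Sum.elim_inl] at h1
    rw [avgPairs_sub_const hn] at h1
    set A := avgPairs n fun i j =>
      ff (a, a') (nullSample Φ ω.1.1 ω.1.2 i, nullSample Φ ω.1.1 ω.1.2 j) with hA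
    set s := (n : ℝ) ^ 2 * ((n.choose 2 : ℕ) : ℝ)⁻¹ with hs
    have h2 : covEst h (nullSample Φ ω.1.1 ω.1.2) a a' = s * A := by
      simp only [covEst, Matrix.of_apply, hs, hA, avgPairs, ff]
      rw [← inv_pow]
      ring
    have h3 : nullCov h (slotNullLaw W Φ) a a' = 2 * m (a, a') := rfl
    rw [h2, h3]
    have hs0 : 0 ≤ s := by positivity
    have h4 : s * A - 2 * m (a, a') = s * (A - m (a, a')) + (s - 2) * m (a, a') := by ring
    have h5 : |s * (A - m (a, a'))| ≤ 4 * (ε / 8) := by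
      rw [abs_mul, abs_of_nonneg hs0]
      exact mul_le_mul hn1.le h1.le (abs_nonneg _) (by norm_num)
    rw [h4]
    refine (abs_add_le _ _).trans_lt ?_
    linarith [hn2 (a, a')]
  · have h1 := hω (Sum.inl a)
    simp only [X, Sum.elim_inl] at h1
    rw [avgPairs_sub_const hn] at h1
    exact h1.trans (by linarith)
  · have h1 := hω (Sum.inr (Sum.inr (b, a)))
    exact h1.trans (by linarith)

end Power

/-! ### Both procedures as instances of resampling from a pool -/

section Transport

/-- There are finitely many sign patterns, so the event is a finite union of measurable slices. -/
theorem measurableSet_rejects {Ω 𝒲 : Type*} [MeasurableSpace Ω] {B c n : ℕ} {α : ℝ} (hα₀ : 0 < α)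
    (hα₁ : α < 1) (Ftr : Fin c → ℤˣ) {h : Fin c → 𝒲 → 𝒲 → ℝ} {w w' : Ω → Fin n → 𝒲}
    (hw : ∀ a i j, Measurable fun ω => h a (w ω i) (w ω j))
    (hw' : ∀ a i j, Measurable fun ω => h a (w' ω i) (w' ω j)) :
    MeasurableSet {ω : Ω × (Fin B → Fin n → ℤˣ) | Rejects α Ftr h (w ω.1) (w' ω.1) ω.2} := by
  have ht : ∀ δ : Fin n → ℤˣ, Measurable fun ω =>
      selStat n Ftr (whiten (covEst h (w' ω)) (wildUStat h (w ω) δ)) := fun δ =>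
    measurable_selStat n Ftr fun a =>
      measurable_whiten (measurable_covEst hw') (fun ω => posSemidef_covEst _ _)
        (measurable_wildUStat hw δ) a
  have hε : ∀ ε : Fin B → Fin n → ℤˣ, MeasurableSet {ω | Rejects α Ftr h (w ω) (w' ω) ε} := by
    intro ε
    simp only [Rejects, uStat_eq_wildUStat]
    refine measurableSet_threshold_lt hα₀ hα₁ (fun b => ?_) (ht 1)
    refine Fin.lastCases ?_ (fun b => ?_) b
    · simpa using ht 1
    · simpa using ht (ε b)
  have hU : {ω : Ω × (Fin B → Fin n → ℤˣ) | Rejects α Ftr h (w ω.1) (w' ω.1) ω.2} =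
      ⋃ ε, {ω | Rejects α Ftr h (w ω) (w' ω) ε} ×ˢ {ε} := by
    ext ω
    simp
  rw [hU]
  exact MeasurableSet.iUnion fun ε => (hε ε).prod (MeasurableSet.singleton ε)

variable {𝒲 S : Type*} [MeasurableSpace 𝒲] [Fintype S]

/-- Transport of the rejection probability along a measure preserving map. -/
theorem measureReal_rejects_eq_poolRejectProb {Ω : Type*} [MeasurableSpace Ω] (μ : Measure Ω)
    [IsProbabilityMeasure μ] {B c n : ℕ} {α : ℝ} (hα₀ : 0 < α) (hα₁ : α < 1) (Ftr : Fin c → ℤˣ)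
    {h : Fin c → 𝒲 → 𝒲 → ℝ} (hh : ∀ a, Measurable fun p : 𝒲 × 𝒲 => h a p.1 p.2)
    (W : Measure 𝒲) [IsProbabilityMeasure W] {Φ : (S → 𝒲 × Fin 2) → 𝒲} (hΦ : Measurable Φ)
    {T : Ω → (Fin n → 𝒲) × (Fin n → S → Fin n × Fin 2)}
    (hT : MeasurePreserving T μ ((Measure.pi fun _ => W).prod (slotLaw S n))) :
    (μ.prod (signLaw B n)).real {ω : Ω × (Fin B → Fin n → ℤˣ) |
      Rejects α Ftr h (T ω.1).1 (nullSample Φ (T ω.1).1 (T ω.1).2) ω.2} =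
      poolRejectProb B α Ftr h W Φ n := by
  have h1 := hT.prod (MeasurePreserving.id (signLaw B n))
  have hw : ∀ a i j, Measurable fun z : (Fin n → 𝒲) × (Fin n → S → Fin n × Fin 2) =>
      h a (z.1 i) (z.1 j) := fun a i j =>
    measurable_core_apply (hh a) (by fun_prop) (by fun_prop)
  have hw' : ∀ a i j, Measurable fun z : (Fin n → 𝒲) × (Fin n → S → Fin n × Fin 2) =>
      h a (nullSample Φ z.1 z.2 i) (nullSample Φ z.1 z.2 j) := fun a i j =>
    measurable_core_apply (hh a) (measurable_nullSample hΦ i) (measurable_nullSample hΦ j)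
  have h2 := measurableSet_rejects (B := B) hα₀ hα₁ Ftr
    (w := fun z : (Fin n → 𝒲) × (Fin n → S → Fin n × Fin 2) => z.1)
    (w' := fun z => nullSample Φ z.1 z.2) hw hw'
  rw [poolRejectProb, measureReal_def, measureReal_def,
    ← h1.measure_preimage h2.nullMeasurableSet]
  rfl

/-- The entry `r` of a pair of observations. -/
def entry {𝒳 : Type*} (p q : 𝒲 → 𝒳) (u : 𝒲 × Fin 2) : 𝒳 := if u.2 = 0 then p u.1 else q u.1

theorem measurable_entry {𝒳 : Type*} [MeasurableSpace 𝒳] {p q : 𝒲 → 𝒳} (hp : Measurable p)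
    (hq : Measurable q) : Measurable (entry p q) :=
  Measurable.ite (measurable_snd (MeasurableSet.singleton 0)) (hp.comp measurable_fst)
    (hq.comp measurable_fst)

/-- The entry label is a fair coin, so the drawn entry has the average of the two laws. -/
theorem map_entry {𝒳 : Type*} [MeasurableSpace 𝒳] (W : Measure 𝒲) [IsProbabilityMeasure W]
    {p q : 𝒲 → 𝒳} (hp : Measurable p) (hq : Measurable q) :
    (W.prod (uniformOn Set.univ)).map (entry p q) = (2⁻¹ : ENNReal) • (W.map p + W.map q) := by
  ext s hs
  have h : entry p q ⁻¹' s = (p ⁻¹' s) ×ˢ {0} ∪ (q ⁻¹' s) ×ˢ {1} := by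
    ext ⟨d, r⟩
    fin_cases r <;> simp [entry]
  rw [Measure.map_apply (measurable_entry hp hq) hs, h, measure_union _
    ((hq hs).prod (MeasurableSet.singleton _)), Measure.prod_prod, Measure.prod_prod]
  · simp [uniformOn_univ, Measure.map_apply hp hs, Measure.map_apply hq hs, mul_comm]
  · exact Set.disjoint_left.mpr fun u h0 h1 => by
      have h2 := h0.2.symm.trans h1.2
      exact absurd h2 (by decide)

omit [MeasurableSpace 𝒲] in
-- Swapping the two entries of an observation is undone by swapping the label; this keeps the null
-- sample fixed under flips.
theorem entry_swap {𝒳 : Type*} {p q : 𝒲 → 𝒳} {τ : 𝒲 → 𝒲} (hp : ∀ d, p (τ d) = q d)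
    (hq : ∀ d, q (τ d) = p d) (u : 𝒲 × Fin 2) :
    entry p q (τ u.1, Equiv.swap 0 1 u.2) = entry p q u := by
  obtain ⟨d, r⟩ := u
  fin_cases r <;> simp [entry, hp, hq]

end Transport

/-! ### Two-sample testing -/

section TwoSample

variable {𝒳 : Type*} [MeasurableSpace 𝒳]

omit [MeasurableSpace 𝒳] in
theorem hMMD_swap_left (κ : 𝒳 → 𝒳 → ℝ) (w w' : 𝒳 × 𝒳) : hMMD κ w.swap w' = -hMMD κ w w' := by
  simp only [hMMD, Prod.fst_swap, Prod.snd_swap]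
  ring

omit [MeasurableSpace 𝒳] in
theorem hMMD_swap_right (κ : 𝒳 → 𝒳 → ℝ) (w w' : 𝒳 × 𝒳) : hMMD κ w w'.swap = -hMMD κ w w' := by
  simp only [hMMD, Prod.fst_swap, Prod.snd_swap]
  ring

theorem IsBoundedCharacteristicKernel.measurable_hMMD {κ : 𝒳 → 𝒳 → ℝ}
    (hκ : IsBoundedCharacteristicKernel κ) :
    Measurable fun p : (𝒳 × 𝒳) × (𝒳 × 𝒳) => hMMD κ p.1 p.2 := by
  have h : ∀ {f g : (𝒳 × 𝒳) × (𝒳 × 𝒳) → 𝒳}, Measurable f → Measurable g →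
      Measurable fun p => κ (f p) (g p) := fun hf hg => measurable_core_apply hκ.measurable hf hg
  exact (((h (by fun_prop) (by fun_prop)).add (h (by fun_prop) (by fun_prop))).sub
    (h (by fun_prop) (by fun_prop))).sub (h (by fun_prop) (by fun_prop))

theorem IsBoundedCharacteristicKernel.exists_abs_hMMD_le {κ : 𝒳 → 𝒳 → ℝ}
    (hκ : IsBoundedCharacteristicKernel κ) : ∃ C : ℝ, ∀ w w', |hMMD κ w w'| ≤ C := by
  obtain ⟨C, hC⟩ := hκ.bounded
  refine ⟨4 * C, fun w w' => ?_⟩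
  have h1 := abs_le.mp (hC w.1 w'.1)
  have h2 := abs_le.mp (hC w.2 w'.2)
  have h3 := abs_le.mp (hC w.1 w'.2)
  have h4 := abs_le.mp (hC w.2 w'.1)
  rw [hMMD, abs_le]
  constructor <;> linarith [h1.1, h1.2, h2.1, h2.2, h3.1, h3.2, h4.1, h4.2]

theorem exists_forall_le_of_finite {ι β : Type*} [Fintype ι] {f : ι → β → ℝ}
    (hf : ∀ i, ∃ C, ∀ x, f i x ≤ C) : ∃ C, ∀ i x, f i x ≤ C := by
  choose C hC using hf
  refine ⟨∑ i, |C i|, fun i x => (hC i x).trans ((le_abs_self _).trans ?_)⟩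
  exact Finset.single_le_sum (f := fun i => |C i|) (fun _ _ => abs_nonneg _) (Finset.mem_univ i)

/-- The pair of entries drawn for a two-sample null observation. -/
def mmdAssemble (u : Fin 2 → (𝒳 × 𝒳) × Fin 2) : 𝒳 × 𝒳 :=
  (entry Prod.fst Prod.snd (u 0), entry Prod.fst Prod.snd (u 1))

theorem measurable_mmdAssemble : Measurable (mmdAssemble (𝒳 := 𝒳)) :=
  ((measurable_entry measurable_fst measurable_snd).comp (measurable_pi_apply 0)).prodMk
    ((measurable_entry measurable_fst measurable_snd).comp (measurable_pi_apply 1))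

theorem slotNullLaw_mmdAssemble (P Q : Measure 𝒳) [IsProbabilityMeasure P]
    [IsProbabilityMeasure Q] : slotNullLaw (P.prod Q) mmdAssemble = mmdNullLaw P Q := by
  have h1 : MeasurePreserving (entry Prod.fst Prod.snd) ((P.prod Q).prod (uniformOn Set.univ))
      ((2⁻¹ : ENNReal) • (P + Q)) := by
    refine ⟨measurable_entry measurable_fst measurable_snd, ?_⟩
    rw [map_entry _ measurable_fst measurable_snd, measurePreserving_fst.map_eq,
      measurePreserving_snd.map_eq]
  have h2 := (h1.prod h1).comp (measurePreserving_finTwoArrow _)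
  exact h2.map_eq

theorem mmdRejectProb_eq {c : ℕ} (B : ℕ) {α : ℝ} (hα₀ : 0 < α) (hα₁ : α < 1) (Ftr : Fin c → ℤˣ)
    {κ : Fin c → 𝒳 → 𝒳 → ℝ} (hκ : ∀ a, IsBoundedCharacteristicKernel (κ a)) (P Q : Measure 𝒳)
    [IsProbabilityMeasure P] [IsProbabilityMeasure Q] (n : ℕ) :
    mmdRejectProb B α Ftr κ P Q n =
      poolRejectProb B α Ftr (fun a => hMMD (κ a)) (P.prod Q) mmdAssemble n := by
  have h1 : MeasurePreserving (fun (z : (Fin n → 𝒳) × (Fin n → 𝒳)) i => (z.1 i, z.2 i))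
      ((Measure.pi fun _ => P).prod (Measure.pi fun _ => Q)) (Measure.pi fun _ => P.prod Q) :=
    (measurePreserving_arrowProdEquivProdArrow 𝒳 𝒳 (Fin n) (fun _ => P) (fun _ => Q)).symm
  have h2 := h1.prod (MeasurePreserving.id (slotLaw (Fin 2) n))
  have : IsProbabilityMeasure (resampleLaw n) :=
    inferInstanceAs (IsProbabilityMeasure (slotLaw (Fin 2) n))
  have h3 := measureReal_rejects_eq_poolRejectProb (B := B) (((Measure.pi fun _ : Fin n => P).prod
    (Measure.pi fun _ : Fin n => Q)).prod (resampleLaw n)) hα₀ hα₁ Ftr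
    (fun a => (hκ a).measurable_hMMD) (P.prod Q) measurable_mmdAssemble h2
  have hres : ∀ (v : Fin n → 𝒳 × 𝒳) J, resample v J = nullSample mmdAssemble v J :=
    fun _ _ => rfl
  simp only [mmdRejectProb, hres]
  exact h3

/-- The flip exchanges `x_i` and `y_i`, which preserves `P ⊗ P`; both slots are relabelled. -/
theorem mmdRejectProb_le {c : ℕ} (B : ℕ) {α : ℝ} (hα₀ : 0 < α) (hα₁ : α < 1) (Ftr : Fin c → ℤˣ)
    {κ : Fin c → 𝒳 → 𝒳 → ℝ} (hκ : ∀ a, IsBoundedCharacteristicKernel (κ a)) (P : Measure 𝒳)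
    [IsProbabilityMeasure P] (n : ℕ) : mmdRejectProb B α Ftr κ P P n ≤ α := by
  rw [mmdRejectProb_eq B hα₀ hα₁ Ftr hκ]
  refine poolRejectProb_le B hα₀ hα₁ Ftr (fun a => (hκ a).measurable_hMMD) measurable_mmdAssemble
    Measure.measurePreserving_swap (fun a => hMMD_swap_left _) (fun a => hMMD_swap_right _)
    (fun _ => Equiv.swap 0 1) (fun u v huv => ?_) n
  have h : ∀ s, entry Prod.fst Prod.snd (v s) = entry Prod.fst Prod.snd (u s) := by
    intro s
    rcases huv s with h | h
    · rw [h]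
    · rw [h]
      exact entry_swap (τ := Prod.swap) (fun _ => rfl) (fun _ => rfl) _
  simp only [mmdAssemble, h]

theorem tendsto_mmdRejectProb {c B : ℕ} {α : ℝ} (hα₀ : 0 < α) (hα₁ : α < 1)
    (hB : 1 ≤ α * ((B : ℝ) + 1)) {Ftr : Fin c → ℤˣ} {κ : Fin c → 𝒳 → 𝒳 → ℝ}
    (hκ : ∀ a, IsBoundedCharacteristicKernel (κ a)) (P Q : Measure 𝒳) [IsProbabilityMeasure P]
    [IsProbabilityMeasure Q] (hS : (nullCov (fun a => hMMD (κ a)) (mmdNullLaw P Q)).PosDef)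
    (hsgn : SignAgreement Ftr (nullCov (fun a => hMMD (κ a)) (mmdNullLaw P Q))
      (popU (fun a => hMMD (κ a)) (mmdLaw P Q))) :
    Tendsto (fun n => mmdRejectProb B α Ftr κ P Q n) atTop (𝓝 1) := by
  simp only [mmdRejectProb_eq B hα₀ hα₁ Ftr hκ]
  rw [← slotNullLaw_mmdAssemble] at hS hsgn
  obtain ⟨C, hC⟩ := exists_forall_le_of_finite
    (f := fun a (p : (𝒳 × 𝒳) × (𝒳 × 𝒳)) => |hMMD (κ a) p.1 p.2|) fun a => by
      obtain ⟨C, hC⟩ := (hκ a).exists_abs_hMMD_le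
      exact ⟨C, fun p => hC _ _⟩
  exact tendsto_poolRejectProb hα₀ hα₁ hB (fun a => (hκ a).measurable_hMMD)
    (fun a w w' => hC a (w, w')) measurable_mmdAssemble hS hsgn

end TwoSample

/-! ### Independence testing -/

section Independence

variable {𝒳 𝒴 : Type*} [MeasurableSpace 𝒳] [MeasurableSpace 𝒴]

theorem measurable_hHSIC {γ : 𝒳 → 𝒳 → ℝ} {l : 𝒴 → 𝒴 → ℝ} (hγ : IsBoundedCharacteristicKernel γ)
    (hl : IsBoundedCharacteristicKernel l) :
    Measurable fun p : ((𝒳 × 𝒳) × (𝒴 × 𝒴)) × ((𝒳 × 𝒳) × (𝒴 × 𝒴)) => hHSIC γ l p.1 p.2 :=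
  ((measurable_core_apply hγ.measurable_hMMD (by fun_prop) (by fun_prop)).const_mul _).mul
    (measurable_core_apply hl.measurable_hMMD (by fun_prop) (by fun_prop))

theorem exists_abs_hHSIC_le {γ : 𝒳 → 𝒳 → ℝ} {l : 𝒴 → 𝒴 → ℝ}
    (hγ : IsBoundedCharacteristicKernel γ) (hl : IsBoundedCharacteristicKernel l) :
    ∃ C : ℝ, ∀ p : ((𝒳 × 𝒳) × (𝒴 × 𝒴)) × ((𝒳 × 𝒳) × (𝒴 × 𝒴)), |hHSIC γ l p.1 p.2| ≤ C := by
  obtain ⟨C, hC⟩ := hγ.exists_abs_hMMD_le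
  obtain ⟨D, hD⟩ := hl.exists_abs_hMMD_le
  refine ⟨1 / 4 * C * D, fun p => ?_⟩
  have hC0 := (abs_nonneg _).trans (hC p.1.1 p.2.1)
  rw [hHSIC, abs_mul, abs_mul, abs_of_nonneg (by norm_num : (0 : ℝ) ≤ 1 / 4)]
  gcongr
  · exact hC _ _
  · exact hD _ _

/-- The quadruple of entries drawn for a null observation of the independence test. -/
def hsicAssemble (u : Fin 2 ⊕ Fin 2 → ((𝒳 × 𝒳) × (𝒴 × 𝒴)) × Fin 2) : (𝒳 × 𝒳) × (𝒴 × 𝒴) :=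
  ((entry (fun d => d.1.1) (fun d => d.1.2) (u (Sum.inl 0)),
    entry (fun d => d.1.1) (fun d => d.1.2) (u (Sum.inl 1))),
   (entry (fun d => d.2.1) (fun d => d.2.2) (u (Sum.inr 0)),
    entry (fun d => d.2.1) (fun d => d.2.2) (u (Sum.inr 1))))

theorem measurable_hsicAssemble : Measurable (hsicAssemble (𝒳 := 𝒳) (𝒴 := 𝒴)) := by
  have hx : Measurable (entry (fun d : (𝒳 × 𝒳) × (𝒴 × 𝒴) => d.1.1) fun d => d.1.2) :=
    measurable_entry (by fun_prop) (by fun_prop)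
  have hy : Measurable (entry (fun d : (𝒳 × 𝒳) × (𝒴 × 𝒴) => d.2.1) fun d => d.2.2) :=
    measurable_entry (by fun_prop) (by fun_prop)
  unfold hsicAssemble
  fun_prop

theorem measurePreserving_hsicLaw (U : Measure (𝒳 × 𝒴)) :
    MeasurePreserving (fun q : (𝒳 × 𝒴) × (𝒳 × 𝒴) => ((q.1.1, q.2.1), (q.1.2, q.2.2)))
      (U.prod U) (hsicLaw U) :=
  ⟨by fun_prop, rfl⟩

instance (U : Measure (𝒳 × 𝒴)) [IsProbabilityMeasure U] : IsProbabilityMeasure (hsicLaw U) :=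
  Measure.isProbabilityMeasure_map (measurePreserving_hsicLaw U).aemeasurable

/-- Under independence all four entries are independent, so exchanging the two `x`'s alone becomes a
symmetry of the law. -/
theorem hsicLaw_prod (A : Measure 𝒳) (D : Measure 𝒴) [IsProbabilityMeasure A]
    [IsProbabilityMeasure D] : hsicLaw (A.prod D) = (A.prod A).prod (D.prod D) := by
  have h1 := measurePreserving_arrowProdEquivProdArrow 𝒳 𝒴 (Fin 2) (fun _ => A) (fun _ => D)
  have h2 := (((measurePreserving_finTwoArrow A).prod (measurePreserving_finTwoArrow D)).comp
    h1).comp (measurePreserving_finTwoArrow (A.prod D)).symm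
  exact h2.map_eq

theorem inv_two_smul_add_self {Z : Type*} [MeasurableSpace Z] (ν : Measure Z) :
    (2⁻¹ : ENNReal) • (ν + ν) = ν := by
  rw [← two_smul ENNReal ν, smul_smul, ENNReal.inv_mul_cancel (by simp) (by simp), one_smul]

theorem map_hsicLaw {Z : Type*} [MeasurableSpace Z] (U : Measure (𝒳 × 𝒴))
    {f : (𝒳 × 𝒳) × (𝒴 × 𝒴) → Z} {g : (𝒳 × 𝒴) × (𝒳 × 𝒴) → Z} {ν : Measure Z} (hf : Measurable f)
    (hg : MeasurePreserving g (U.prod U) ν)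
    (hfg : (f ∘ fun q : (𝒳 × 𝒴) × (𝒳 × 𝒴) => ((q.1.1, q.2.1), (q.1.2, q.2.2))) = g) :
    (hsicLaw U).map f = ν := by
  rw [hsicLaw, Measure.map_map hf (measurePreserving_hsicLaw U).measurable, hfg, hg.map_eq]

/-- Both `x`-entries of a quadruple have the same marginal law, so the mixture over the label
collapses to it; likewise for `y`. Distinct slots are independent, which decouples the `x`'s from
the `y`'s. -/
theorem slotNullLaw_hsicAssemble (U : Measure (𝒳 × 𝒴)) [IsProbabilityMeasure U] :
    slotNullLaw (hsicLaw U) hsicAssemble = hsicNullLaw U := by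
  have hfst : MeasurePreserving Prod.fst U U.fst := ⟨measurable_fst, rfl⟩
  have hsnd : MeasurePreserving Prod.snd U U.snd := ⟨measurable_snd, rfl⟩
  have hx : MeasurePreserving (entry (fun d : (𝒳 × 𝒳) × (𝒴 × 𝒴) => d.1.1) fun d => d.1.2)
      ((hsicLaw U).prod (uniformOn Set.univ)) U.fst := by
    refine ⟨measurable_entry (by fun_prop) (by fun_prop), ?_⟩
    rw [map_entry _ (by fun_prop) (by fun_prop),
      map_hsicLaw U (by fun_prop) (hfst.comp measurePreserving_fst) rfl,
      map_hsicLaw U (by fun_prop) (hfst.comp measurePreserving_snd) rfl, inv_two_smul_add_self]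
  have hy : MeasurePreserving (entry (fun d : (𝒳 × 𝒳) × (𝒴 × 𝒴) => d.2.1) fun d => d.2.2)
      ((hsicLaw U).prod (uniformOn Set.univ)) U.snd := by
    refine ⟨measurable_entry (by fun_prop) (by fun_prop), ?_⟩
    rw [map_entry _ (by fun_prop) (by fun_prop),
      map_hsicLaw U (by fun_prop) (hsnd.comp measurePreserving_fst) rfl,
      map_hsicLaw U (by fun_prop) (hsnd.comp measurePreserving_snd) rfl, inv_two_smul_add_self]
  have h1 := measurePreserving_sumPiEquivProdPi (ι := Fin 2) (ι' := Fin 2)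
    (X := fun _ => ((𝒳 × 𝒳) × (𝒴 × 𝒴)) × Fin 2)
    (fun _ => (hsicLaw U).prod (uniformOn Set.univ))
  have h2 := (((hx.prod hx).comp (measurePreserving_finTwoArrow _)).prod
    ((hy.prod hy).comp (measurePreserving_finTwoArrow _))).comp h1
  exact h2.map_eq

theorem measurePreserving_quadruples (U : Measure (𝒳 × 𝒴)) [IsProbabilityMeasure U] (m : ℕ) :
    MeasurePreserving (quadruples (m := m)) (Measure.pi fun _ => U)
      (Measure.pi fun _ => hsicLaw U) := by
  -- The indices `i` and `i + m / 2` are all distinct and below `m`; for odd `m` the last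
  -- observation is dropped.
  let k : Fin (m / 2) × Fin 2 → Fin m := fun p =>
    if p.2 = 0 then ⟨p.1, by omega⟩ else ⟨p.1 + m / 2, by omega⟩
  have hk : k.Injective := by
    rintro ⟨i, r⟩ ⟨j, s⟩ h
    fin_cases r <;> fin_cases s <;> simp [k] at h ⊢ <;> omega
  have h1 := (measurePreserving_uncurry (ι := Fin (m / 2)) (κ := Fin 2) U).symm.comp
    (measurePreserving_comp_injective U hk)
  have h2 := measurePreserving_pi _ _ fun _ : Fin (m / 2) =>
    (measurePreserving_hsicLaw U).comp (measurePreserving_finTwoArrow U)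
  exact h2.comp h1

/-- The index families `J` and `K` are merged into one family over `Fin 2 ⊕ Fin 2`, with the
`x`-slots on the left and the `y`-slots on the right. -/
theorem hsicRejectProb_eq {c : ℕ} (B : ℕ) {α : ℝ} (hα₀ : 0 < α) (hα₁ : α < 1) (Ftr : Fin c → ℤˣ)
    {γ : Fin c → 𝒳 → 𝒳 → ℝ} {l : Fin c → 𝒴 → 𝒴 → ℝ}
    (hγ : ∀ a, IsBoundedCharacteristicKernel (γ a)) (hl : ∀ a, IsBoundedCharacteristicKernel (l a))
    (U : Measure (𝒳 × 𝒴)) [IsProbabilityMeasure U] (m : ℕ) :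
    hsicRejectProb B α Ftr γ l U m =
      poolRejectProb B α Ftr (fun a => hHSIC (γ a) (l a)) (hsicLaw U) hsicAssemble (m / 2) := by
  set n := m / 2
  have : IsProbabilityMeasure (resampleLaw n) :=
    inferInstanceAs (IsProbabilityMeasure (slotLaw (Fin 2) n))
  let ρ : Measure (Fin 2 → Fin n × Fin 2) := Measure.pi fun _ => uniformOn Set.univ
  have h1 : MeasurePreserving (fun (z : (Fin n → Fin 2 → Fin n × Fin 2) ×
      (Fin n → Fin 2 → Fin n × Fin 2)) i => (z.1 i, z.2 i))
      ((resampleLaw n).prod (resampleLaw n)) (Measure.pi fun _ => ρ.prod ρ) :=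
    (measurePreserving_arrowProdEquivProdArrow _ _ (Fin n) (fun _ => ρ) (fun _ => ρ)).symm
  have h2 : MeasurePreserving (fun (z : Fin n → (Fin 2 → Fin n × Fin 2) × (Fin 2 → Fin n × Fin 2))
      i => (MeasurableEquiv.sumPiEquivProdPi fun _ : Fin 2 ⊕ Fin 2 => Fin n × Fin 2).symm (z i))
      (Measure.pi fun _ => ρ.prod ρ) (slotLaw (Fin 2 ⊕ Fin 2) n) :=
    measurePreserving_pi _ _ fun _ => measurePreserving_sumPiEquivProdPi_symm
      fun _ : Fin 2 ⊕ Fin 2 => uniformOn Set.univ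
  have h3 := (measurePreserving_quadruples U m).prod (h2.comp h1)
  have h4 := measureReal_rejects_eq_poolRejectProb (B := B) ((Measure.pi fun _ : Fin m => U).prod
    ((resampleLaw n).prod (resampleLaw n))) hα₀ hα₁ Ftr
    (fun a => measurable_hHSIC (hγ a) (hl a)) (hsicLaw U) measurable_hsicAssemble h3
  have hres : ∀ (w : Fin n → (𝒳 × 𝒳) × (𝒴 × 𝒴)) (J K : Fin n → Fin 2 → Fin n × Fin 2),
      (fun i => (resample (fun k => (w k).1) J i, resample (fun k => (w k).2) K i)) =
      nullSample hsicAssemble w fun i =>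
        (MeasurableEquiv.sumPiEquivProdPi fun _ : Fin 2 ⊕ Fin 2 => Fin n × Fin 2).symm
          (J i, K i) := fun _ _ _ => rfl
  rw [← h4]
  simp only [hsicRejectProb]
  refine congrArg _ (Set.ext fun ω => ?_)
  exact iff_of_eq (congrArg (fun w' => Rejects α Ftr (fun a => hHSIC (γ a) (l a))
    (quadruples ω.1.1) w' ω.2) (hres (quadruples ω.1.1) ω.1.2.1 ω.1.2.2))

/-- Only the `x`-pair is swapped. This negates one factor of the core function, and only the
`x`-slots need relabelling, because the `y`-entries do not move. -/
theorem hsicRejectProb_le {c : ℕ} (B : ℕ) {α : ℝ} (hα₀ : 0 < α) (hα₁ : α < 1) (Ftr : Fin c → ℤˣ)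
    {γ : Fin c → 𝒳 → 𝒳 → ℝ} {l : Fin c → 𝒴 → 𝒴 → ℝ}
    (hγ : ∀ a, IsBoundedCharacteristicKernel (γ a)) (hl : ∀ a, IsBoundedCharacteristicKernel (l a))
    (U : Measure (𝒳 × 𝒴)) [IsProbabilityMeasure U] (hU : U = U.fst.prod U.snd) (m : ℕ) :
    hsicRejectProb B α Ftr γ l U m ≤ α := by
  rw [hsicRejectProb_eq B hα₀ hα₁ Ftr hγ hl]
  let τ : (𝒳 × 𝒳) × (𝒴 × 𝒴) → (𝒳 × 𝒳) × (𝒴 × 𝒴) := Prod.map Prod.swap id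
  have hτ : MeasurePreserving τ (hsicLaw U) (hsicLaw U) := by
    rw [hU, hsicLaw_prod]
    exact Measure.measurePreserving_swap.prod (MeasurePreserving.id _)
  refine poolRejectProb_le B hα₀ hα₁ Ftr (fun a => measurable_hHSIC (hγ a) (hl a))
    measurable_hsicAssemble hτ (fun a w w' => ?_) (fun a w w' => ?_)
    (Sum.elim (fun _ => Equiv.swap 0 1) fun _ => Equiv.refl _) (fun u v huv => ?_) _
  · simp only [hHSIC, τ, Prod.map_fst, Prod.map_snd, hMMD_swap_left, id]
    ring
  · simp only [hHSIC, τ, Prod.map_fst, Prod.map_snd, hMMD_swap_right, id]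
    ring
  · have hx : ∀ s, entry (fun d : (𝒳 × 𝒳) × (𝒴 × 𝒴) => d.1.1) (fun d => d.1.2) (v (Sum.inl s)) =
        entry (fun d => d.1.1) (fun d => d.1.2) (u (Sum.inl s)) := by
      intro s
      rcases huv (Sum.inl s) with h | h
      · rw [h]
      · rw [h]
        exact entry_swap (τ := τ) (fun _ => rfl) (fun _ => rfl) _
    have hy : ∀ s, entry (fun d : (𝒳 × 𝒳) × (𝒴 × 𝒴) => d.2.1) (fun d => d.2.2) (v (Sum.inr s)) =
        entry (fun d => d.2.1) (fun d => d.2.2) (u (Sum.inr s)) := by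
      intro s
      rcases huv (Sum.inr s) with h | h
      · rw [h]
      · rw [h]
        rfl
    simp only [hsicAssemble, hx, hy]

theorem tendsto_hsicRejectProb {c B : ℕ} {α : ℝ} (hα₀ : 0 < α) (hα₁ : α < 1)
    (hB : 1 ≤ α * ((B : ℝ) + 1)) {Ftr : Fin c → ℤˣ}
    {γ : Fin c → 𝒳 → 𝒳 → ℝ} {l : Fin c → 𝒴 → 𝒴 → ℝ}
    (hγ : ∀ a, IsBoundedCharacteristicKernel (γ a)) (hl : ∀ a, IsBoundedCharacteristicKernel (l a))
    (U : Measure (𝒳 × 𝒴)) [IsProbabilityMeasure U]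
    (hS : (nullCov (fun a => hHSIC (γ a) (l a)) (hsicNullLaw U)).PosDef)
    (hsgn : SignAgreement Ftr (nullCov (fun a => hHSIC (γ a) (l a)) (hsicNullLaw U))
      (popU (fun a => hHSIC (γ a) (l a)) (hsicLaw U))) :
    Tendsto (fun m => hsicRejectProb B α Ftr γ l U m) atTop (𝓝 1) := by
  simp only [hsicRejectProb_eq B hα₀ hα₁ Ftr hγ hl]
  rw [← slotNullLaw_hsicAssemble] at hS hsgn
  obtain ⟨C, hC⟩ := exists_forall_le_of_finite fun a => exists_abs_hHSIC_le (hγ a) (hl a)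
  have h1 := tendsto_poolRejectProb hα₀ hα₁ hB (fun a => measurable_hHSIC (hγ a) (hl a))
    (fun a w w' => hC a (w, w')) measurable_hsicAssemble hS hsgn
  exact h1.comp (Nat.tendsto_div_const_atTop two_ne_zero)

end Independence

end DUAL

end

theorem theorem1 {𝒳 𝒴 : Type*} [MeasurableSpace 𝒳] [MeasurableSpace 𝒴]
    (c B : ℕ) (α : ℝ) (hα₀ : 0 < α) (hα₁ : α < 1) (Ftr : Fin c → ℤˣ) :
    -- two-sample testing
    (∀ κ : Fin c → 𝒳 → 𝒳 → ℝ, (∀ a, DUAL.IsBoundedCharacteristicKernel (κ a)) →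
      ∀ P Q : Measure 𝒳, IsProbabilityMeasure P → IsProbabilityMeasure Q →
        (P = Q → ∀ n, DUAL.mmdRejectProb B α Ftr κ P Q n ≤ α) ∧
        (P ≠ Q → 1 ≤ α * ((B : ℝ) + 1) →
          (DUAL.nullCov (fun a => DUAL.hMMD (κ a)) (DUAL.mmdNullLaw P Q)).PosDef →
          DUAL.SignAgreement Ftr
            (DUAL.nullCov (fun a => DUAL.hMMD (κ a)) (DUAL.mmdNullLaw P Q))
            (DUAL.popU (fun a => DUAL.hMMD (κ a)) (DUAL.mmdLaw P Q)) →
          Tendsto (fun n => DUAL.mmdRejectProb B α Ftr κ P Q n) atTop (𝓝 1))) ∧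
    -- independence testing
    (∀ (γ : Fin c → 𝒳 → 𝒳 → ℝ) (l : Fin c → 𝒴 → 𝒴 → ℝ),
      (∀ a, DUAL.IsBoundedCharacteristicKernel (γ a)) →
      (∀ a, DUAL.IsBoundedCharacteristicKernel (l a)) →
      ∀ U : Measure (𝒳 × 𝒴), IsProbabilityMeasure U →
        (U = U.fst.prod U.snd → ∀ m, DUAL.hsicRejectProb B α Ftr γ l U m ≤ α) ∧
        (U ≠ U.fst.prod U.snd → 1 ≤ α * ((B : ℝ) + 1) →
          (DUAL.nullCov (fun a => DUAL.hHSIC (γ a) (l a)) (DUAL.hsicNullLaw U)).PosDef →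
          DUAL.SignAgreement Ftr
            (DUAL.nullCov (fun a => DUAL.hHSIC (γ a) (l a)) (DUAL.hsicNullLaw U))
            (DUAL.popU (fun a => DUAL.hHSIC (γ a) (l a)) (DUAL.hsicLaw U)) →
          Tendsto (fun m => DUAL.hsicRejectProb B α Ftr γ l U m) atTop (𝓝 1))) := by
  refine ⟨fun κ hκ P Q hP hQ => ⟨fun hPQ n => ?_, fun _ hB hS hsgn => ?_⟩,
    fun γ l hγ hl U hU => ⟨fun h m => ?_, fun _ hB hS hsgn => ?_⟩⟩
  · subst hPQ
    exact DUAL.mmdRejectProb_le B hα₀ hα₁ Ftr hκ P n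
  · exact DUAL.tendsto_mmdRejectProb hα₀ hα₁ hB hκ P Q hS hsgn
  · exact DUAL.hsicRejectProb_le B hα₀ hα₁ Ftr hγ hl U h m
  · exact DUAL.tendsto_hsicRejectProb hα₀ hα₁ hB hγ hl U hS hsgn
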